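/- Let $n, t \ge 0$ be integers, let $f_1, \dots, f_t \in \mathbb{C}[x_1, \dots, x_n]$ be irreducible and pairwise coprime (for $i \ne j$, $f_i$ and $f_j$ have no non-unit common factor), let $a_1, \dots, a_t \ge 1$ be integers, and let $$A = \frac{\mathbb{C}[u, v, x_1, \dots, x_n]}{(uv - f_1^{a_1} \cdots f_t^{a_t})}$$ (an empty product is $1$). Suppose that $A$ has Krull dimension $2$ (equivalently, $n = 1$). Then $A$ is a normal noetherian integral domain, and there is an isomorphism of abelian groups $$G_0(A) \cong \mathbb{Z} \oplus \mathrm{Cl}(A).$$ Here $G_0(A)$ is the Grothendieck group of the category of finitely generated $A$-modules: the abelian group generated by symbols $[M]$, one for each finitely generated $A$-module $M$, with one relation $[M] = [M'] + [M'']$ for every short exact sequence $0 \to M' \to M \to M'' \to 0$. The divisor class group $\mathrm{Cl}(A)$ is the cokernel of $$\mathrm{div} \colon Q(A)^{\times} \to \bigoplus_{\mathfrak{p}} \mathbb{Z}\,\mathfrak{p}, \qquad x \mapsto \sum_{\mathfrak{p}} \nu_{\mathfrak{p}}(x)\, \mathfrak{p},$$ where $Q(A)$ is the field of fractions of $A$,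 $\mathfrak{p}$ runs over the prime ideals of height one, and $\nu_{\mathfrak{p}}$ is the normalised valuation of the discrete valuation ring $A_{\mathfrak{p}}$. -/

import Mathlib

noncomputable section

/-! ### The divisor class group of a normal noetherian domain -/

/-- The set of height one prime ideals of `R`. -/
def HeightOnePrime (R : Type*) [CommRing R] : Type _ :=
  {p : PrimeSpectrum R // p.asIdeal.height = 1}

section WeilDivisors

variable (R : Type*) [CommRing R] [IsDomain R] [IsNoetherianRing R]

/-- In a noetherian domain only finitely many height one primes contain a given nonzero element. -/
theorem HeightOnePrime.finite_mem {a : R} (ha : a ≠ 0) :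
    {p : HeightOnePrime R | a ∈ p.1.asIdeal}.Finite := by
  have hfin := Ideal.finite_minimalPrimes_of_isNoetherianRing R (Ideal.span {a})
  refine Set.Finite.of_finite_image (f := fun p : HeightOnePrime R => p.1.asIdeal)
    (hfin.subset ?_) ?_
  · rintro _ ⟨p, hp, rfl⟩
    have hp' : a ∈ p.1.asIdeal := hp
    refine Ideal.mem_minimalPrimes_of_height_le
      ((Ideal.span_singleton_le_iff_mem _).2 hp') ?_
    rw [p.2]
    exact Ideal.one_le_height_span_singleton_of_mem_nonZeroDivisors
      (mem_nonZeroDivisors_of_ne_zero ha)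
  · intro p _ q _ h
    exact Subtype.ext (PrimeSpectrum.ext h)

variable [IsIntegrallyClosed R]

variable {R} in
/-- The localisation of a normal noetherian domain at a height one prime is a discrete
valuation ring. -/
instance HeightOnePrime.isDiscreteValuationRing (p : HeightOnePrime R) :
    IsDiscreteValuationRing (Localization.AtPrime p.1.asIdeal) := by
  have hmax : (IsLocalRing.maximalIdeal (Localization.AtPrime p.1.asIdeal)).height = 1 := by
    have h1 := IsLocalRing.maximalIdeal_height_eq_ringKrullDim
      (R := Localization.AtPrime p.1.asIdeal)
    rw [IsLocalization.AtPrime.ringKrullDim_eq_height p.1.asIdeal, p.2] at h1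
    exact_mod_cast h1
  have hne := Ideal.ne_bot_of_height_eq_one hmax
  have hic : IsIntegrallyClosed (Localization.AtPrime p.1.asIdeal) :=
    isIntegrallyClosed_of_isLocalization _ p.1.asIdeal.primeCompl
      p.1.asIdeal.primeCompl_le_nonZeroDivisors
  have hfield : ¬ IsField (Localization.AtPrime p.1.asIdeal) :=
    fun h => hne (IsLocalRing.isField_iff_maximalIdeal_eq.1 h)
  suffices h : IsIntegrallyClosed (Localization.AtPrime p.1.asIdeal) ∧
      ∃! P : Ideal (Localization.AtPrime p.1.asIdeal), P ≠ ⊥ ∧ P.IsPrime from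
    ((IsDiscreteValuationRing.TFAE (Localization.AtPrime p.1.asIdeal) hfield).out 3 0).1 h
  refine ⟨hic, IsLocalRing.maximalIdeal _, ⟨hne, inferInstance⟩, ?_⟩
  rintro P ⟨hP0, hP⟩
  by_contra hPm
  have hlt := lt_of_le_of_ne (IsLocalRing.le_maximalIdeal hP.ne_top) hPm
  have h2 := Ideal.height_add_one_le_of_lt_of_isPrime hlt
  rw [hmax] at h2
  have h3 : P.height ≠ 0 := fun h => hP0 (Ideal.height_eq_zero_iff_eq_bot.1 h)
  have h4 : (1 : ℕ∞) ≤ P.height := Order.one_le_iff_pos.2 (pos_iff_ne_zero.2 h3)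
  have h5 : (1 : ℕ∞) + 1 ≤ 1 := (add_le_add_left h4 1).trans h2
  exact absurd h5 (by decide)

variable {R}

instance HeightOnePrime.isFractionRing (p : HeightOnePrime R) :
    IsFractionRing (Localization.AtPrime p.1.asIdeal) (FractionRing R) :=
  IsFractionRing.isFractionRing_of_isDomain_of_isLocalization p.1.asIdeal.primeCompl _ _

/-- The normalised discrete valuation `ν_p : Q(R)ˣ → ℤ` of the discrete valuation ring `R_p`.
Mathlib's valuation is multiplicative with `v x = exp (-ν_p x)`, whence the sign. -/
def HeightOnePrime.ord (p : HeightOnePrime R) (x : FractionRing R) : ℤ :=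
  -WithZero.log ((IsDiscreteValuationRing.maximalIdeal
    (Localization.AtPrime p.1.asIdeal)).valuation (FractionRing R) x)

theorem HeightOnePrime.ord_mul (p : HeightOnePrime R) {x y : FractionRing R}
    (hx : x ≠ 0) (hy : y ≠ 0) : p.ord (x * y) = p.ord x + p.ord y := by
  unfold HeightOnePrime.ord
  rw [map_mul, WithZero.log_mul ((Valuation.ne_zero_iff _).2 hx) ((Valuation.ne_zero_iff _).2 hy)]
  ring

theorem HeightOnePrime.ord_algebraMap_of_notMem (p : HeightOnePrime R) {a : R}
    (ha : a ∉ p.1.asIdeal) : p.ord (algebraMap R (FractionRing R) a) = 0 := by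
  unfold HeightOnePrime.ord
  have hu : IsUnit (algebraMap R (Localization.AtPrime p.1.asIdeal) a) :=
    IsLocalization.map_units _ (⟨a, ha⟩ : p.1.asIdeal.primeCompl)
  rw [IsScalarTower.algebraMap_apply R (Localization.AtPrime p.1.asIdeal) (FractionRing R),
    (IsDedekindDomain.HeightOneSpectrum.valuation_eq_one_iff_notMem _).2]
  · simp
  · exact fun h => (IsLocalRing.mem_maximalIdeal _).1 h hu

theorem HeightOnePrime.finite_ord_ne_zero {x : FractionRing R} (hx : x ≠ 0) :
    {p : HeightOnePrime R | p.ord x ≠ 0}.Finite := by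
  obtain ⟨a, b, hb, rfl⟩ := IsFractionRing.div_surjective (A := R) x
  have hb0 : b ≠ 0 := nonZeroDivisors.ne_zero hb
  have ha0 : a ≠ 0 := by
    rintro rfl
    simp at hx
  refine ((HeightOnePrime.finite_mem R ha0).union (HeightOnePrime.finite_mem R hb0)).subset ?_
  intro p hp
  by_contra hmem
  simp only [Set.mem_union, Set.mem_ofPred_eq, not_or] at hmem
  apply hp
  have hbK : algebraMap R (FractionRing R) b ≠ 0 := by simpa using hb0
  have h := p.ord_mul hx hbK
  rw [div_mul_cancel₀ _ hbK, p.ord_algebraMap_of_notMem hmem.1,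
    p.ord_algebraMap_of_notMem hmem.2] at h
  linarith

variable (R)

/-- The group of Weil divisors: the free abelian group on the height one primes. -/
abbrev WeilDivisor : Type _ := HeightOnePrime R →₀ ℤ

/-- The homomorphism `div : Q(R)ˣ → Div(R)`, `x ↦ ∑ p, ν_p(x) • p`. -/
def WeilDivisor.div : Additive (FractionRing R)ˣ →+ WeilDivisor R :=
  AddMonoidHom.mk'
    (fun x => Finsupp.ofSupportFinite (fun p => p.ord (x.toMul : FractionRing R))
      (HeightOnePrime.finite_ord_ne_zero x.toMul.ne_zero))
    (fun x y => Finsupp.ext fun p => p.ord_mul x.toMul.ne_zero y.toMul.ne_zero)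

/-- The divisor class group `Cl(R)`: the cokernel of `div : Q(R)ˣ → Div(R)`. -/
abbrev DivisorClassGroup : Type _ := WeilDivisor R ⧸ (WeilDivisor.div R).range

end WeilDivisors

/-! ### The Grothendieck group of finitely generated modules -/

/-- The relations `[M] = [M'] + [M'']`, one for each short exact sequence
`0 → M' → M → M'' → 0` of finitely generated `R`-modules. -/
def G0.relations (R : Type) [CommRing R] : Set (FreeAbelianGroup (FGModuleCat.{0} R)) :=
  {z | ∃ (M' M M'' : FGModuleCat.{0} R) (f : M' →ₗ[R] M) (g : M →ₗ[R] M''),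
    Function.Injective f ∧ Function.Exact f g ∧ Function.Surjective g ∧
    z = FreeAbelianGroup.of M - (FreeAbelianGroup.of M' + FreeAbelianGroup.of M'')}

/-- The Grothendieck group `G₀(R) = K₀(mod R)` of finitely generated `R`-modules. Isomorphic modules
have the same class by the relation of `0 → M → M' → 0 → 0`. -/
abbrev G0 (R : Type) [CommRing R] : Type 1 :=
  FreeAbelianGroup (FGModuleCat.{0} R) ⧸ AddSubgroup.closure (G0.relations R)

/-! ### The ring `ℂ[u, v, x₁, …, xₙ] / (u v - f₁ ^ a₁ ⋯ fₜ ^ aₜ)` -/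

/-- The polynomial `u v - f₁ ^ a₁ ⋯ fₜ ^ aₜ` in `ℂ[u, v, x₁, …, xₙ]`. The variables `u`, `v` are
indexed by `Fin 2` and the variables `x₁, …, xₙ` by `Fin n`. -/
def viehwegPoly {n t : ℕ} (f : Fin t → MvPolynomial (Fin n) ℂ) (a : Fin t → ℕ) :
    MvPolynomial (Fin 2 ⊕ Fin n) ℂ :=
  MvPolynomial.X (Sum.inl 0) * MvPolynomial.X (Sum.inl 1) -
    MvPolynomial.rename Sum.inr (∏ i, f i ^ a i)

/-- The ring `ℂ[u, v, x₁, …, xₙ] / (u v - f₁ ^ a₁ ⋯ fₜ ^ aₜ)`. -/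
abbrev ViehwegRing {n t : ℕ} (f : Fin t → MvPolynomial (Fin n) ℂ) (a : Fin t → ℕ) : Type :=
  MvPolynomial (Fin 2 ⊕ Fin n) ℂ ⧸ Ideal.span {viehwegPoly f a}

end

/-!
The theorem splits into a statement about normal noetherian domains and a computation for the
rings `A = ℂ[u, v, x₁, …, xₙ] / (u v - g)`.

Let `R` be a normal noetherian domain such that `[R ⧸ q] = 0` in `G₀(R)` for every prime `q` of
height at least two. Then `G₀(R) ≅ ℤ ⊕ Cl(R)` (`G0.nonempty_equiv`). In one direction send
`(1, 0)` to `[R]` and a height one prime `p` to `[R ⧸ p]`. A prime filtration shows that a torsion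
module `T` has class `∑ p, length (T_p) • [R ⧸ p]` (`G0.ofDivisor_lengthDivisor`); for
`T = R ⧸ (a)` this says that principal divisors go to zero. In the other direction a module is
sent to its rank and its first Chern class (`rankClass`). The latter is the class in `Cl(R)` of
the divisor of `M ⧸ F`, where `F ⊆ M` is free with torsion quotient. It does not depend on `F`,
since the cokernel of a nonsingular square matrix has a principal divisor
(`Matrix.cokerClass_eq_zero`). This is proved without localising, by factoring the matrix over the
fraction field into transvections and diagonal matrices. The second map is a left inverse of the
first, as one sees on `[R]` and `[R ⧸ p]`, and the first is surjective, again by a prime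
filtration.

The ring `A` is a domain because `u v - g` is irreducible. It is normal because `A[1/u]` and
`A[1/v]` are localisations of polynomial rings and `A = A[1/u] ∩ A[1/v]`, the element `u` being a
nonzerodivisor modulo `v`. It has dimension `n + 1`, so `n = 1`, and the primes of height at least
two are the closed points of the surface `u v = g(x)`. Each of them lies on a closed curve
isomorphic to the affine line: on the curve `u = u₀` with coordinate `x` if `u₀ ≠ 0`, and on the
line `u = 0`, `x = x₀` with coordinate `v` if `u₀ = 0`. On an affine line the ideal of a point is
principal, so the class of the point is `[ℂ[X]] - [ℂ[X]] = 0`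
(`ViehwegRing.of_quotient_eq_zero_of_isMaximal`).
-/

noncomputable section

/-! ### Lengths at height one primes -/

section LocalLength

open TensorProduct

variable {R : Type*} [CommRing R]

/-- The length over `R_p` of the `R`-module `M` localised at `p`. The localisation is taken as the
base change `R_p ⊗ M`. -/
def HeightOnePrime.localLength (p : HeightOnePrime R) (M : Type*) [AddCommGroup M] [Module R M] :
    ℕ∞ :=
  Module.length (Localization.AtPrime p.1.asIdeal) (Localization.AtPrime p.1.asIdeal ⊗[R] M)

namespace HeightOnePrime

variable (p : HeightOnePrime R)
variable {M M' M'' : Type*} [AddCommGroup M] [Module R M] [AddCommGroup M'] [Module R M']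
  [AddCommGroup M''] [Module R M'']

theorem localLength_of_exact (f : M' →ₗ[R] M) (g : M →ₗ[R] M'') (hf : Function.Injective f)
    (hfg : Function.Exact f g) (hg : Function.Surjective g) :
    p.localLength M = p.localLength M' + p.localLength M'' :=
  Module.length_eq_add_of_exact
    (AlgebraTensorModule.lTensor (Localization.AtPrime p.1.asIdeal)
      (Localization.AtPrime p.1.asIdeal) f)
    (AlgebraTensorModule.lTensor (Localization.AtPrime p.1.asIdeal)
      (Localization.AtPrime p.1.asIdeal) g)
    (Module.Flat.lTensor_preserves_injective_linearMap f hf)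
    (LinearMap.lTensor_surjective _ hg)
    (lTensor_exact (Localization.AtPrime p.1.asIdeal) hfg hg)

theorem localLength_congr (e : M ≃ₗ[R] M') : p.localLength M = p.localLength M' :=
  (AlgebraTensorModule.congr
    (LinearEquiv.refl (Localization.AtPrime p.1.asIdeal) _) e).length_eq

theorem localLength_pi {ι : Type*} [Fintype ι] (N : ι → Type*) [∀ i, AddCommGroup (N i)]
    [∀ i, Module R (N i)] :
    p.localLength (∀ i, N i) = ∑ i, p.localLength (N i) := by
  classical
  unfold localLength
  rw [← Module.length_pi_of_fintype]
  exact (TensorProduct.piRight R (Localization.AtPrime p.1.asIdeal)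
    (Localization.AtPrime p.1.asIdeal) N).length_eq

theorem localLength_of_subsingleton [Subsingleton M] : p.localLength M = 0 := by
  unfold localLength
  exact Module.length_eq_zero

theorem localLength_quotient (I : Ideal R) :
    p.localLength (R ⧸ I) = Module.length (Localization.AtPrime p.1.asIdeal)
      (Localization.AtPrime p.1.asIdeal ⧸
        I.map (algebraMap R (Localization.AtPrime p.1.asIdeal))) :=
  (Algebra.TensorProduct.quotIdealMapEquivTensorQuot
    (Localization.AtPrime p.1.asIdeal) I).toLinearEquiv.length_eq.symm

theorem localLength_eq_zero_of_smul {a : R} (ha : a ∉ p.1.asIdeal) (h : ∀ x : M, a • x = 0) :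
    p.localLength M = 0 := by
  unfold localLength
  rw [Module.length_eq_zero_iff]
  refine subsingleton_of_forall_eq 0 fun z => ?_
  have hu : IsUnit (algebraMap R (Localization.AtPrime p.1.asIdeal) a) :=
    IsLocalization.map_units _ (⟨a, ha⟩ : p.1.asIdeal.primeCompl)
  have hz : algebraMap R (Localization.AtPrime p.1.asIdeal) a • z = 0 := by
    induction z with
    | zero => simp
    | tmul s x => rw [algebraMap_smul, ← TensorProduct.tmul_smul, h, TensorProduct.tmul_zero]
    | add x y hx hy => rw [smul_add, hx, hy, add_zero]
  exact (hu.smul_eq_zero).1 hz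

theorem localLength_quotient_self : p.localLength (R ⧸ p.1.asIdeal) = 1 := by
  rw [localLength_quotient, IsLocalization.AtPrime.map_eq_maximalIdeal, Module.length_eq_one_iff,
    isSimpleModule_iff_isCoatom, ← Ideal.isMaximal_def]
  infer_instance

/-- A prime `q ≠ 0` different from the height one prime `p` is not contained in `p`, so that
`(R ⧸ q)_p = 0`. -/
theorem localLength_quotient_of_ne [IsDomain R] (q : Ideal R) [q.IsPrime] (hq : q ≠ ⊥)
    (hqp : q ≠ p.1.asIdeal) : p.localLength (R ⧸ q) = 0 := by
  have hle : ¬ q ≤ p.1.asIdeal := fun hle => by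
    have h2 := Ideal.height_add_one_le_of_lt_of_isPrime (lt_of_le_of_ne hle hqp)
    rw [p.2] at h2
    have h3 : q.height ≠ 0 := fun h => hq (Ideal.height_eq_zero_iff_eq_bot.1 h)
    have h4 : (1 : ℕ∞) ≤ q.height := Order.one_le_iff_pos.2 (pos_iff_ne_zero.2 h3)
    have h5 : (1 : ℕ∞) + 1 ≤ 1 := (add_le_add_left h4 1).trans h2
    exact absurd h5 (by decide)
  obtain ⟨a, haq, hap⟩ := SetLike.not_le_iff_exists.1 hle
  refine p.localLength_eq_zero_of_smul hap fun x => ?_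
  obtain ⟨x, rfl⟩ := Ideal.Quotient.mk_surjective x
  rw [Algebra.smul_def, Ideal.Quotient.algebraMap_eq, ← map_mul, Ideal.Quotient.eq_zero_iff_mem]
  exact q.mul_mem_right _ haq

/-- Torsion modules, that is, finitely generated modules killed by a nonzero ring element, have
finite length at height one primes. -/
theorem localLength_ne_top [IsDomain R] [IsNoetherianRing R] [Module.Finite R M]
    (h : Module.annihilator R M ≠ ⊥) : p.localLength M ≠ ⊤ := by
  induction ‹Module.Finite R M› using
    IsNoetherianRing.induction_on_isQuotientEquivQuotientPrime R with
  | subsingleton N => simp [localLength_of_subsingleton]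
  | quotient N q e =>
    rw [e.annihilator_eq, Ideal.annihilator_quotient] at h
    rw [p.localLength_congr e]
    by_cases hqp : q.1 = p.1.asIdeal
    · rw [hqp, localLength_quotient_self]
      simp
    · rw [localLength_quotient_of_ne p q.1 h hqp]
      simp
  | exact N₁ N₂ N₃ f g hf hg hfg h₁ h₃ =>
    rw [p.localLength_of_exact f g hf hfg hg]
    exact WithTop.add_ne_top.2 ⟨h₁ (ne_bot_of_le_ne_bot h (f.annihilator_le_of_injective hf)),
      h₃ (ne_bot_of_le_ne_bot h (g.annihilator_le_of_surjective hg))⟩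

theorem localLength_quotient_span_singleton [IsDomain R] [IsNoetherianRing R]
    [IsIntegrallyClosed R] {a : R} (ha : a ≠ 0) :
    ((p.localLength (R ⧸ Ideal.span {a})).toNat : ℤ) =
      p.ord (algebraMap R (FractionRing R) a) := by
  have hinj : Function.Injective (algebraMap R (Localization.AtPrime p.1.asIdeal)) :=
    IsLocalization.injective _ p.1.asIdeal.primeCompl_le_nonZeroDivisors
  have ha' : algebraMap R (Localization.AtPrime p.1.asIdeal) a ≠ 0 := by
    rwa [Ne, map_eq_zero_iff _ hinj]
  rw [localLength_quotient, Ideal.map_span, Set.image_singleton]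
  change ((Ring.ord _ (algebraMap R (Localization.AtPrime p.1.asIdeal) a)).toNat : ℤ) = _
  have h1 := Ring.ordMonoidWithZeroHom_eq_intValuation (mem_nonZeroDivisors_of_ne_zero ha')
  have h2 := Ring.ordMonoidWithZeroHom_eq_ordMonoidHom
    (⟨_, mem_nonZeroDivisors_of_ne_zero ha'⟩ : nonZeroDivisors (Localization.AtPrime p.1.asIdeal))
  unfold ord
  rw [IsScalarTower.algebraMap_apply R (Localization.AtPrime p.1.asIdeal) (FractionRing R),
    IsDedekindDomain.HeightOneSpectrum.valuation_of_algebraMap, ← inv_inv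
    ((IsDiscreteValuationRing.maximalIdeal _).intValuation _), ← h1, ← h2, WithZero.log_inv]
  rw [neg_neg]
  rfl

end HeightOnePrime

end LocalLength

/-! ### The divisor of a torsion module -/

section LengthDivisor

variable (R : Type*) [CommRing R]

open Classical in
/-- The divisor `∑ p, length (M_p) • p` of a finitely generated torsion module `M`. It is set to
zero if infinitely many coefficients are nonzero, and infinite lengths are read as zero; neither
happens for a finitely generated torsion module over a noetherian domain. -/
def lengthDivisor (M : Type*) [AddCommGroup M] [Module R M] : WeilDivisor R :=
  if h : (Function.support fun p : HeightOnePrime R => ((p.localLength M).toNat : ℤ)).Finite then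
    Finsupp.ofSupportFinite _ h else 0

variable {R}
variable {M M' M'' : Type*} [AddCommGroup M] [Module R M] [AddCommGroup M'] [Module R M']
  [AddCommGroup M''] [Module R M'']

theorem lengthDivisor_congr (e : M ≃ₗ[R] M') : lengthDivisor R M = lengthDivisor R M' := by
  have h : (fun p : HeightOnePrime R => p.localLength M) = fun p => p.localLength M' :=
    funext fun p => p.localLength_congr e
  unfold lengthDivisor
  simp only [funext_iff] at h
  congr! 4 <;> simp only [h]

theorem lengthDivisor_of_subsingleton [Subsingleton M] : lengthDivisor R M = 0 := by
  unfold lengthDivisor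
  split_ifs
  · ext p
    simp [Finsupp.ofSupportFinite, HeightOnePrime.localLength_of_subsingleton]
  · rfl

variable [IsDomain R] [IsNoetherianRing R]

theorem lengthDivisor_apply (h : Module.annihilator R M ≠ ⊥) (p : HeightOnePrime R) :
    lengthDivisor R M p = (p.localLength M).toNat := by
  unfold lengthDivisor
  rw [dif_pos]
  · rfl
  · obtain ⟨a, ha, ha0⟩ := Submodule.exists_mem_ne_zero_of_ne_bot h
    refine (HeightOnePrime.finite_mem R ha0).subset fun p hp => ?_
    by_contra hap
    exact hp (by simp [p.localLength_eq_zero_of_smul hap (Module.mem_annihilator.1 ha)])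

theorem lengthDivisor_of_exact [Module.Finite R M] [Module.Finite R M'] [Module.Finite R M'']
    (h : Module.annihilator R M ≠ ⊥) (f : M' →ₗ[R] M) (g : M →ₗ[R] M'')
    (hf : Function.Injective f) (hfg : Function.Exact f g) (hg : Function.Surjective g) :
    lengthDivisor R M = lengthDivisor R M' + lengthDivisor R M'' := by
  have h' := ne_bot_of_le_ne_bot h (f.annihilator_le_of_injective hf)
  have h'' := ne_bot_of_le_ne_bot h (g.annihilator_le_of_surjective hg)
  ext p
  rw [Finsupp.add_apply, lengthDivisor_apply h, lengthDivisor_apply h', lengthDivisor_apply h'',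
    p.localLength_of_exact f g hf hfg hg,
    ENat.toNat_add (p.localLength_ne_top h') (p.localLength_ne_top h'')]
  push_cast
  rfl

theorem lengthDivisor_quotient_self (p : HeightOnePrime R) :
    lengthDivisor R (R ⧸ p.1.asIdeal) = Finsupp.single p 1 := by
  have hp : p.1.asIdeal ≠ ⊥ := Ideal.ne_bot_of_height_eq_one p.2
  ext q
  rw [lengthDivisor_apply (by rwa [Ideal.annihilator_quotient])]
  by_cases hqp : p = q
  · subst hqp
    simp [HeightOnePrime.localLength_quotient_self]
  · rw [q.localLength_quotient_of_ne _ hp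
      fun h => hqp (Subtype.ext (PrimeSpectrum.ext h)), Finsupp.single_eq_of_ne' hqp]
    simp

/-- A nonzero prime contained in a height one prime is equal to it. -/
theorem lengthDivisor_quotient_of_height_ne_one (q : Ideal R) [q.IsPrime] (hq : q ≠ ⊥)
    (hht : q.height ≠ 1) : lengthDivisor R (R ⧸ q) = 0 := by
  ext p
  rw [lengthDivisor_apply (by rwa [Ideal.annihilator_quotient]),
    p.localLength_quotient_of_ne q hq (fun h => hht (h ▸ p.2))]
  simp

theorem lengthDivisor_quotient_span_singleton [IsIntegrallyClosed R] {a : R} (ha : a ≠ 0)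
    (x : (FractionRing R)ˣ) (hx : (x : FractionRing R) = algebraMap R (FractionRing R) a) :
    lengthDivisor R (R ⧸ Ideal.span {a}) = WeilDivisor.div R (Additive.ofMul x) := by
  ext p
  rw [lengthDivisor_apply, p.localLength_quotient_span_singleton ha, ← hx]
  · rfl
  · rwa [Ideal.annihilator_quotient, Ne, Ideal.span_singleton_eq_bot]

end LengthDivisor

/-! ### Cokernels of nonsingular matrices -/

section TorsionClass

variable {R : Type*} [CommRing R]
variable {M M' M'' : Type*} [AddCommGroup M] [Module R M] [AddCommGroup M'] [Module R M']
  [AddCommGroup M''] [Module R M'']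

/-- For composable maps `h : M' → M` and `i : M → M''` with `i` injective, the cokernel of `i ∘ h`
is an extension of the cokernel of `i` by the cokernel of `h`. -/
theorem exact_coker_comp (h : M' →ₗ[R] M) (i : M →ₗ[R] M'') (hi : Function.Injective i) :
    ∃ (f : (M ⧸ LinearMap.range h) →ₗ[R] M'' ⧸ LinearMap.range (i ∘ₗ h))
      (g : (M'' ⧸ LinearMap.range (i ∘ₗ h)) →ₗ[R] M'' ⧸ LinearMap.range i),
      Function.Injective f ∧ Function.Exact f g ∧ Function.Surjective g := by
  refine ⟨Submodule.mapQ _ _ i ?_, Submodule.mapQ _ _ LinearMap.id ?_, ?_, ?_, ?_⟩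
  · rintro _ ⟨x, rfl⟩
    exact ⟨x, rfl⟩
  · rintro _ ⟨x, rfl⟩
    exact ⟨h x, rfl⟩
  · rw [injective_iff_map_eq_zero]
    intro x hx
    obtain ⟨x, rfl⟩ := Submodule.mkQ_surjective _ x
    obtain ⟨y, hy⟩ := (Submodule.Quotient.mk_eq_zero _).1 hx
    exact (Submodule.Quotient.mk_eq_zero _).2 ⟨y, hi hy⟩
  · intro x
    obtain ⟨x, rfl⟩ := Submodule.mkQ_surjective _ x
    constructor
    · intro hx
      obtain ⟨y, rfl⟩ := (Submodule.Quotient.mk_eq_zero _).1 hx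
      exact ⟨Submodule.mkQ _ y, rfl⟩
    · rintro ⟨y, hy⟩
      obtain ⟨y, rfl⟩ := Submodule.mkQ_surjective _ y
      rw [← hy]
      exact (Submodule.Quotient.mk_eq_zero _).2 ⟨y, rfl⟩
  · intro x
    obtain ⟨x, rfl⟩ := Submodule.mkQ_surjective _ x
    exact ⟨Submodule.mkQ _ x, rfl⟩

theorem Matrix.annihilator_coker_ne_bot {n : Type*} [Fintype n] [DecidableEq n]
    {A : Matrix n n R} (hA : A.det ≠ 0) :
    Module.annihilator R ((n → R) ⧸ LinearMap.range A.mulVecLin) ≠ ⊥ := by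
  refine Submodule.ne_bot_iff _ |>.2 ⟨A.det, Module.mem_annihilator.2 fun x => ?_, hA⟩
  obtain ⟨x, rfl⟩ := Submodule.mkQ_surjective _ x
  rw [← map_smul, Submodule.mkQ_apply, Submodule.Quotient.mk_eq_zero]
  refine ⟨A.adjugate.mulVec x, ?_⟩
  rw [Matrix.mulVecLin_apply, Matrix.mulVec_mulVec, Matrix.mul_adjugate, Matrix.smul_mulVec,
    Matrix.one_mulVec]

variable [IsDomain R]

/-- Extensions of torsion modules are torsion. For finitely generated modules over a domain, being
torsion is expressed throughout as having a nonzero annihilator. -/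
theorem Module.annihilator_ne_bot_of_exact (f : M' →ₗ[R] M) (g : M →ₗ[R] M'')
    (hfg : Function.Exact f g) (h' : Module.annihilator R M' ≠ ⊥)
    (h'' : Module.annihilator R M'' ≠ ⊥) : Module.annihilator R M ≠ ⊥ := by
  obtain ⟨a, ha, ha0⟩ := Submodule.exists_mem_ne_zero_of_ne_bot h'
  obtain ⟨b, hb, hb0⟩ := Submodule.exists_mem_ne_zero_of_ne_bot h''
  refine Submodule.ne_bot_iff _ |>.2 ⟨a * b, ?_, mul_ne_zero ha0 hb0⟩
  rw [Module.mem_annihilator] at *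
  intro m
  obtain ⟨m', hm'⟩ := (hfg (b • m)).1 (by rw [map_smul, hb])
  rw [mul_smul, ← hm', ← map_smul, ha, map_zero]

theorem Matrix.mulVecLin_injective_of_det_ne_zero {n : Type*} [Fintype n] [DecidableEq n]
    {A : Matrix n n R} (hA : A.det ≠ 0) :
    Function.Injective A.mulVecLin :=
  (injective_iff_map_eq_zero _).2 fun _ hv => Matrix.eq_zero_of_mulVec_eq_zero hA hv

variable [IsNoetherianRing R] [IsIntegrallyClosed R]

variable (R M) in
/-- The class in `Cl(R)` of the divisor of a finitely generated torsion module. -/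
def torsionClass : DivisorClassGroup R := QuotientAddGroup.mk (lengthDivisor R M)

theorem torsionClass_congr (e : M ≃ₗ[R] M') : torsionClass R M = torsionClass R M' := by
  rw [torsionClass, lengthDivisor_congr e, torsionClass]

theorem torsionClass_of_subsingleton [Subsingleton M] : torsionClass R M = 0 := by
  rw [torsionClass, lengthDivisor_of_subsingleton, QuotientAddGroup.mk_zero]

theorem torsionClass_of_exact [Module.Finite R M] [Module.Finite R M'] [Module.Finite R M'']
    (h : Module.annihilator R M ≠ ⊥) (f : M' →ₗ[R] M) (g : M →ₗ[R] M'')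
    (hf : Function.Injective f) (hfg : Function.Exact f g) (hg : Function.Surjective g) :
    torsionClass R M = torsionClass R M' + torsionClass R M'' := by
  simp only [torsionClass]
  rw [lengthDivisor_of_exact h f g hf hfg hg, QuotientAddGroup.mk_add]

theorem torsionClass_coker_comp [Module.Finite R M] [Module.Finite R M']
    [Module.Finite R M''] (h : M' →ₗ[R] M) (i : M →ₗ[R] M'') (hi : Function.Injective i)
    (hh' : Module.annihilator R (M ⧸ LinearMap.range h) ≠ ⊥)
    (hi' : Module.annihilator R (M'' ⧸ LinearMap.range i) ≠ ⊥) :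
    torsionClass R (M'' ⧸ LinearMap.range (i ∘ₗ h)) =
      torsionClass R (M ⧸ LinearMap.range h) + torsionClass R (M'' ⧸ LinearMap.range i) := by
  obtain ⟨f, g, hf, hfg, hg⟩ := exact_coker_comp h i hi
  exact torsionClass_of_exact (Module.annihilator_ne_bot_of_exact f g hfg hh' hi') f g hf hfg hg

/-- The divisor of `R ⧸ (a)` is the principal divisor of `a`. -/
theorem torsionClass_quotient_span_singleton {a : R} (ha : a ≠ 0) :
    torsionClass R (R ⧸ Ideal.span {a}) = 0 := by
  have ha' : algebraMap R (FractionRing R) a ≠ 0 := by simpa using ha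
  rw [torsionClass, lengthDivisor_quotient_span_singleton ha (Units.mk0 _ ha') rfl,
    QuotientAddGroup.eq_zero_iff]
  exact ⟨_, rfl⟩

theorem torsionClass_pi {ι : Type*} [Fintype ι] (N : ι → Type*) [∀ i, AddCommGroup (N i)]
    [∀ i, Module R (N i)] [∀ i, Module.Finite R (N i)]
    (h : ∀ i, Module.annihilator R (N i) ≠ ⊥) :
    torsionClass R (∀ i, N i) = ∑ i, torsionClass R (N i) := by
  have hpi : Module.annihilator R (∀ i, N i) ≠ ⊥ := by
    choose a ha ha0 using fun i => Submodule.exists_mem_ne_zero_of_ne_bot (h i)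
    refine Submodule.ne_bot_iff _ |>.2 ⟨∏ i, a i, ?_, Finset.prod_ne_zero_iff.2 fun i _ => ha0 i⟩
    rw [Module.mem_annihilator]
    refine fun x => funext fun i => ?_
    obtain ⟨c, hc⟩ := Finset.dvd_prod_of_mem a (Finset.mem_univ i)
    rw [Pi.smul_apply, hc, mul_comm, mul_smul, Module.mem_annihilator.1 (ha i), smul_zero]
    rfl
  have hdiv : lengthDivisor R (∀ i, N i) = ∑ i, lengthDivisor R (N i) := by
    ext p
    rw [Finsupp.finsetSum_apply, lengthDivisor_apply hpi, p.localLength_pi,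
      ENat.toNat_sum fun i _ => p.localLength_ne_top (h i)]
    push_cast
    exact Finset.sum_congr rfl fun i _ => (lengthDivisor_apply (h i) p).symm
  simp only [torsionClass, hdiv]
  exact map_sum (QuotientAddGroup.mk' (WeilDivisor.div R).range) _ _

section Matrix

open Matrix

variable {n : Type*} [Fintype n] [DecidableEq n]

/-- The class in `Cl(R)` of the cokernel of a square matrix. -/
def Matrix.cokerClass (A : Matrix n n R) : DivisorClassGroup R :=
  torsionClass R ((n → R) ⧸ LinearMap.range A.mulVecLin)

theorem Matrix.cokerClass_mul {A B : Matrix n n R} (hA : A.det ≠ 0) (hB : B.det ≠ 0) :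
    (A * B).cokerClass = A.cokerClass + B.cokerClass := by
  simp only [cokerClass]
  rw [mulVecLin_mul, torsionClass_coker_comp _ _ (mulVecLin_injective_of_det_ne_zero hA)
    (annihilator_coker_ne_bot hB) (annihilator_coker_ne_bot hA), add_comm]

theorem Matrix.cokerClass_of_isUnit_det {A : Matrix n n R} (hA : IsUnit A.det) :
    A.cokerClass = 0 := by
  have hsurj : LinearMap.range A.mulVecLin = ⊤ := by
    refine LinearMap.range_eq_top.2 fun x => ⟨A⁻¹ *ᵥ x, ?_⟩
    rw [mulVecLin_apply, mulVec_mulVec, mul_nonsing_inv _ hA, one_mulVec]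
  have : Subsingleton ((n → R) ⧸ LinearMap.range A.mulVecLin) :=
    Submodule.Quotient.subsingleton_iff.2 hsurj
  exact torsionClass_of_subsingleton

theorem Matrix.cokerClass_diagonal {b : n → R} (hb : ∀ i, b i ≠ 0) :
    (diagonal b).cokerClass = 0 := by
  let q : (n → R) →ₗ[R] ∀ i, R ⧸ Ideal.span {b i} :=
    LinearMap.pi fun i => (Submodule.mkQ (Ideal.span {b i})).comp (LinearMap.proj i)
  have hq : Function.Surjective q := fun y => by
    choose x hx using fun i => Submodule.mkQ_surjective _ (y i)
    exact ⟨x, funext hx⟩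
  have hker : LinearMap.range (diagonal b).mulVecLin = LinearMap.ker q := by
    ext x
    rw [LinearMap.mem_ker, funext_iff]
    have hx : ∀ i, q x i = 0 ↔ b i ∣ x i := fun i =>
      (Submodule.Quotient.mk_eq_zero _).trans Ideal.mem_span_singleton
    simp only [Pi.zero_apply, hx]
    constructor
    · rintro ⟨y, rfl⟩ i
      exact ⟨y i, by simp [mulVec_diagonal]⟩
    · intro h
      choose y hy using h
      exact ⟨y, funext fun i => by simp [mulVec_diagonal, hy i]⟩
  rw [cokerClass, torsionClass_congr ((Submodule.quotEquivOfEq _ _ hker).trans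
    (q.quotKerEquivOfSurjective hq)), torsionClass_pi]
  · exact Finset.sum_eq_zero fun i _ => torsionClass_quotient_span_singleton (hb i)
  · intro i
    rw [Ideal.annihilator_quotient, Ne, Ideal.span_singleton_eq_bot]
    exact hb i

/-- The cokernel class is additive on products, and over the fraction field every nonsingular
matrix is a product of transvections and diagonal matrices. Hence the cokernel of any nonsingular
matrix has the class of a sum of modules `R ⧸ (a)`, which is zero. -/
theorem Matrix.cokerClass_eq_zero {A : Matrix n n R} (hA : A.det ≠ 0) : A.cokerClass = 0 := by
  let φ := algebraMap R (FractionRing R)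
  have hφ : Function.Injective φ := IsFractionRing.injective R (FractionRing R)
  have hscalar : ∀ d : R, d ≠ 0 → (diagonal fun _ : n => d).det ≠ 0 := fun d hd => by
    rw [det_diagonal]
    exact Finset.prod_ne_zero_iff.2 fun _ _ => hd
  have hdet : ∀ (N : Matrix n n (FractionRing R)) (d : R) (B : Matrix n n R), d ≠ 0 →
      B.map φ = φ d • N → N.det ≠ 0 → B.det ≠ 0 := fun N d B hd hB hN h => by
    have h1 : φ B.det = φ d ^ Fintype.card n * N.det := by
      rw [← det_smul, ← hB, RingHom.map_det, RingHom.mapMatrix_apply]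
    rw [h, map_zero] at h1
    exact mul_ne_zero (pow_ne_zero _ ((map_ne_zero_iff φ hφ).2 hd)) hN h1.symm
  suffices h : ∀ (d : R) (B : Matrix n n R), d ≠ 0 → B.map φ = φ d • A.map φ →
      B.cokerClass = 0 from h 1 A one_ne_zero (by simp)
  have hA' : (A.map φ).det ≠ 0 := by
    rw [← RingHom.mapMatrix_apply, ← RingHom.map_det]
    exact (map_ne_zero_iff φ hφ).2 hA
  -- The induction runs over matrices with entries in the fraction field, so the assertion is made
  -- for all their multiples with entries in `R`.
  refine diagonal_transvection_induction_of_det_ne_zero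
    (fun N => ∀ (d : R) (B : Matrix n n R), d ≠ 0 → B.map φ = φ d • N → B.cokerClass = 0)
    (A.map φ) hA' ?_ ?_ ?_
  · intro D hD d B hd hB
    have hB' : B = diagonal fun i => B i i := by
      ext i j
      by_cases hij : i = j
      · subst hij
        simp
      · refine hφ ?_
        have := congr_fun₂ hB i j
        simpa [diagonal_apply_ne _ hij] using this
    rw [hB']
    refine cokerClass_diagonal fun i hi => ?_
    have h0 := hdet _ d B hd hB hD
    rw [hB', det_diagonal] at h0
    exact Finset.prod_ne_zero_iff.1 h0 i (Finset.mem_univ i) hi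
  · rintro ⟨i, j, hij, c⟩ d B hd hB
    have hB' : B = diagonal (fun _ => d) + single i j (B i j) := by
      ext k l
      refine hφ ?_
      have h1 := congr_fun₂ hB k l
      have h2 := congr_fun₂ hB i j
      simp only [map_apply, TransvectionStruct.toMatrix, transvection, smul_apply,
        Matrix.add_apply, one_apply, single_apply, smul_eq_mul, hij, if_false, and_self, if_true,
        zero_add] at h1 h2
      rw [h1, Matrix.add_apply, map_add, single_apply, diagonal_apply]
      by_cases hkl : k = l
      · subst hkl
        have : ¬ (i = k ∧ j = k) := fun h => hij (h.1.trans h.2.symm)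
        simp [this]
      · by_cases h : i = k ∧ j = l
        · simp [h, hkl, h1]
        · simp [h, hkl]
    -- Conjugation by `S` turns the entry `B i j / d` of the transvection into `B i j`.
    let S : Matrix n n R := diagonal (Function.update 1 j d)
    have hS0 : ∀ k, Function.update (1 : n → R) j d k ≠ 0 := fun k => by
      by_cases hk : k = j
      · subst hk
        simpa using hd
      · simp [hk]
    have hSdet : S.det ≠ 0 := by
      rw [det_diagonal]
      exact Finset.prod_ne_zero_iff.2 fun k _ => hS0 k
    have hmul : B * S = diagonal (fun _ => d) * S * transvection i j (B i j) := by
      rw [hB']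
      ext k l
      simp only [S, transvection, diagonal_mul_diagonal, Matrix.add_apply, diagonal_mul,
        mul_diagonal, single_apply, diagonal_apply, one_apply]
      by_cases h : i = k ∧ j = l
      · obtain ⟨rfl, rfl⟩ := h
        simp [hij, mul_comm]
      · by_cases hkl : k = l
        · subst hkl
          simp [h]
        · simp [h, hkl]
    have hBdet : B.det ≠ 0 := hdet _ d B hd hB (by
      rw [TransvectionStruct.det]
      exact one_ne_zero)
    have hT : (transvection i j (B i j)).det = 1 := det_transvection_of_ne i j hij _
    have hT0 : (transvection i j (B i j)).cokerClass = 0 :=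
      cokerClass_of_isUnit_det (by rw [hT]; exact isUnit_one)
    have h := congr_arg cokerClass hmul
    rwa [cokerClass_mul hBdet hSdet, cokerClass_mul (by
        rw [det_mul]
        exact mul_ne_zero (hscalar d hd) hSdet) (by rw [hT]; exact one_ne_zero),
      cokerClass_mul (hscalar d hd) hSdet, cokerClass_diagonal hS0,
      hT0, cokerClass_diagonal fun _ => hd,
      add_zero, add_zero, add_zero] at h
  · intro M N hM hN ihM ihN d B hd hB
    have hint : ∀ N : Matrix n n (FractionRing R), ∃ (e : R) (C : Matrix n n R), e ≠ 0 ∧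
        C.map φ = φ e • N := fun N => by
      obtain ⟨e, he⟩ := IsLocalization.exist_integer_multiples_of_finite (nonZeroDivisors R)
        (fun ij : n × n => N ij.1 ij.2)
      choose C hC using he
      refine ⟨e, of fun i j => C (i, j), nonZeroDivisors.coe_ne_zero e, ?_⟩
      ext i j
      rw [map_apply, of_apply, hC, smul_apply, Algebra.smul_def]
      rfl
    obtain ⟨e, C, he, hC⟩ := hint M
    obtain ⟨e', C', he', hC'⟩ := hint N
    have hmul : diagonal (fun _ => e * e') * B = diagonal (fun _ => d) * (C * C') := by
      refine map_injective hφ ?_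
      beta_reduce
      rw [Matrix.map_mul, Matrix.map_mul, Matrix.map_mul, hB, hC, hC', diagonal_map (map_zero φ),
        diagonal_map (map_zero φ)]
      simp only [← smul_eq_diagonal_mul, smul_mul_assoc, mul_smul_comm,
        smul_smul, map_mul]
      congr 1
      ring
    have hBdet : B.det ≠ 0 := hdet _ d B hd hB (by
      rw [det_mul]
      exact mul_ne_zero hM hN)
    have hCdet := hdet _ e C he hC hM
    have hCdet' := hdet _ e' C' he' hC' hN
    have h := congr_arg cokerClass hmul
    rwa [cokerClass_mul (hscalar _ (mul_ne_zero he he')) hBdet,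
      cokerClass_mul (hscalar d hd) (by rw [det_mul]; exact mul_ne_zero hCdet hCdet'),
      cokerClass_mul hCdet hCdet', ihM e C he hC, ihN e' C' he' hC',
      cokerClass_diagonal fun _ => hd, cokerClass_diagonal fun _ => mul_ne_zero he he',
      zero_add, add_zero, add_zero] at h

end Matrix

end TorsionClass

/-! ### Rank and first Chern class of a finitely generated module -/

section RankClass

variable {R : Type*} [CommRing R]
variable {M M' M'' : Type*} [AddCommGroup M] [Module R M] [AddCommGroup M'] [Module R M']
  [AddCommGroup M''] [Module R M'']

/-- An embedding of a free module of finite rank in `M` with torsion cokernel. -/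
structure IsFrame {ι : Type*} (i : (ι → R) →ₗ[R] M) : Prop where
  injective : Function.Injective i
  annihilator_coker_ne_bot : Module.annihilator R (M ⧸ LinearMap.range i) ≠ ⊥

theorem IsFrame.comp_equiv {ι κ : Type*} {i : (ι → R) →ₗ[R] M} (hi : IsFrame i)
    (e : (κ → R) ≃ₗ[R] ι → R) : IsFrame (i ∘ₗ e.toLinearMap) where
  injective := hi.injective.comp e.injective
  annihilator_coker_ne_bot := by
    rw [LinearMap.range_comp, LinearEquiv.range, ← LinearMap.range_eq_map]
    exact hi.annihilator_coker_ne_bot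

/-- Frames of the outer terms of a short exact sequence combine to a frame of the middle term whose
cokernel is an extension of the two given cokernels. -/
theorem IsFrame.exists_of_exact [IsDomain R] {ι ι' : Type*} [Finite ι'] (f : M' →ₗ[R] M)
    (g : M →ₗ[R] M'') (hf : Function.Injective f) (hfg : Function.Exact f g)
    (hg : Function.Surjective g)
    {i : (ι → R) →ₗ[R] M'} (hi : IsFrame i) {i' : (ι' → R) →ₗ[R] M''} (hi' : IsFrame i') :
    ∃ j : (ι ⊕ ι' → R) →ₗ[R] M, IsFrame j ∧
      ∃ (F : (M' ⧸ LinearMap.range i) →ₗ[R] M ⧸ LinearMap.range j)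
        (G : (M ⧸ LinearMap.range j) →ₗ[R] M'' ⧸ LinearMap.range i'),
        Function.Injective F ∧ Function.Exact F G ∧ Function.Surjective G := by
  classical
  obtain ⟨s, hs⟩ := Module.projective_lifting_property g i' hg
  have hs' : ∀ y, g (s y) = i' y := fun y => LinearMap.congr_fun hs y
  have hgf : ∀ x, g (f x) = 0 := hfg.apply_apply_eq_zero
  let j : (ι ⊕ ι' → R) →ₗ[R] M :=
    f ∘ₗ i ∘ₗ LinearMap.funLeft R R Sum.inl + s ∘ₗ LinearMap.funLeft R R Sum.inr
  have hj : ∀ x, j x = f (i (x ∘ Sum.inl)) + s (x ∘ Sum.inr) := fun x => rfl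
  have hgj : ∀ x, g (j x) = i' (x ∘ Sum.inr) := fun x => by
    rw [hj, map_add, hgf, hs', zero_add]
  have hinj : Function.Injective j := by
    rw [injective_iff_map_eq_zero]
    intro x hx
    have h2 : x ∘ Sum.inr = 0 := (injective_iff_map_eq_zero _).1 hi'.injective _ (by
      rw [← hgj, hx, map_zero])
    have h1 : x ∘ Sum.inl = 0 := (injective_iff_map_eq_zero (f ∘ₗ i)).1
      (hf.comp hi.injective) _ (by rw [hj, h2, map_zero, add_zero] at hx; exact hx)
    funext k
    rcases k with k | k
    · exact congr_fun h1 k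
    · exact congr_fun h2 k
  let F : (M' ⧸ LinearMap.range i) →ₗ[R] M ⧸ LinearMap.range j := Submodule.mapQ _ _ f (by
    rintro _ ⟨x, rfl⟩
    exact ⟨Sum.elim x 0, by simp [hj]⟩)
  let G : (M ⧸ LinearMap.range j) →ₗ[R] M'' ⧸ LinearMap.range i' := Submodule.mapQ _ _ g (by
    rintro _ ⟨x, rfl⟩
    exact ⟨x ∘ Sum.inr, (hgj x).symm⟩)
  have hF : Function.Injective F := by
    rw [injective_iff_map_eq_zero]
    intro x hx
    obtain ⟨x, rfl⟩ := Submodule.mkQ_surjective _ x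
    obtain ⟨y, hy⟩ := (Submodule.Quotient.mk_eq_zero _).1 hx
    have h2 : y ∘ Sum.inr = 0 := (injective_iff_map_eq_zero _).1 hi'.injective _ (by
      rw [← hgj, hy, hgf])
    rw [hj, h2, map_zero, add_zero] at hy
    exact (Submodule.Quotient.mk_eq_zero _).2 ⟨_, hf hy⟩
  have hFG : Function.Exact F G := by
    intro x
    obtain ⟨x, rfl⟩ := Submodule.mkQ_surjective _ x
    constructor
    · intro hx
      obtain ⟨y, hy⟩ := (Submodule.Quotient.mk_eq_zero _).1 hx
      obtain ⟨z, hz⟩ := (hfg (x - s y)).1 (by rw [map_sub, hs', hy, sub_self])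
      refine ⟨Submodule.mkQ _ z, (Submodule.Quotient.eq _).2 ⟨Sum.elim 0 (-y), ?_⟩⟩
      rw [hz, hj]
      simp
    · rintro ⟨y, hy⟩
      obtain ⟨y, rfl⟩ := Submodule.mkQ_surjective _ y
      rw [← hy]
      exact (Submodule.Quotient.mk_eq_zero _).2 ⟨0, by rw [hgf, map_zero]⟩
  have hG : Function.Surjective G := fun x => by
    obtain ⟨x, rfl⟩ := Submodule.mkQ_surjective _ x
    obtain ⟨y, rfl⟩ := hg x
    exact ⟨Submodule.mkQ _ y, rfl⟩
  exact ⟨j, ⟨hinj, Module.annihilator_ne_bot_of_exact F G hFG hi.annihilator_coker_ne_bot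
    hi'.annihilator_coker_ne_bot⟩, F, G, hF, hFG, hG⟩

theorem isFrame_zero_of_annihilator_ne_bot (h : Module.annihilator R M ≠ ⊥) :
    IsFrame (0 : (Fin 0 → R) →ₗ[R] M) where
  injective := Function.injective_of_subsingleton _
  annihilator_coker_ne_bot :=
    ne_bot_of_le_ne_bot h ((Submodule.mkQ _).annihilator_le_of_surjective
      (Submodule.mkQ_surjective _))

theorem isFrame_of_linearEquiv [Nontrivial R] {ι : Type*} (e : (ι → R) ≃ₗ[R] M) :
    IsFrame e.toLinearMap where
  injective := e.injective
  annihilator_coker_ne_bot := by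
    have : Subsingleton (M ⧸ LinearMap.range e.toLinearMap) :=
      Submodule.Quotient.subsingleton_iff.2 e.range
    rw [Module.annihilator_eq_top_iff.2 this]
    exact top_ne_bot

theorem exists_isFrame [IsDomain R] [IsNoetherianRing R] [Module.Finite R M] :
    ∃ (r : ℕ) (i : (Fin r → R) →ₗ[R] M), IsFrame i := by
  induction ‹Module.Finite R M› using
    IsNoetherianRing.induction_on_isQuotientEquivQuotientPrime R with
  | subsingleton N =>
    exact ⟨0, 0, isFrame_zero_of_annihilator_ne_bot (by
      rw [Module.annihilator_eq_top_iff.2 inferInstance]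
      exact top_ne_bot)⟩
  | quotient N q e =>
    by_cases hq : q.1 = ⊥
    · exact ⟨1, _, isFrame_of_linearEquiv ((LinearEquiv.funUnique (Fin 1) R R).trans
        ((Submodule.quotEquivOfEqBot q.1 hq).symm.trans e.symm))⟩
    · exact ⟨0, 0, isFrame_zero_of_annihilator_ne_bot (by
        rwa [e.annihilator_eq, Ideal.annihilator_quotient])⟩
  | exact N₁ N₂ N₃ f g hf hg hfg h₁ h₃ =>
    obtain ⟨r, i, hi⟩ := h₁
    obtain ⟨r', i', hi'⟩ := h₃
    obtain ⟨j, hj, -⟩ := hi.exists_of_exact f g hf hfg hg hi'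
    exact ⟨r + r', _, hj.comp_equiv (LinearEquiv.funCongrLeft R R finSumFinEquiv)⟩

variable [IsDomain R]

/-- Two frames are related by an injective linear map, up to a nonzero factor. -/
theorem IsFrame.exists_smul_eq {ι κ : Type*} {i : (ι → R) →ₗ[R] M} {j : (κ → R) →ₗ[R] M}
    (hi : IsFrame i) (hj : IsFrame j) : ∃ (a : R) (h : (κ → R) →ₗ[R] ι → R), a ≠ 0 ∧
      Function.Injective h ∧ i ∘ₗ h = a • j := by
  obtain ⟨a, ha, ha0⟩ := Submodule.exists_mem_ne_zero_of_ne_bot hi.annihilator_coker_ne_bot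
  rw [Module.mem_annihilator] at ha
  have hmem : ∀ x, (a • j) x ∈ LinearMap.range i := fun x =>
    (Submodule.Quotient.mk_eq_zero _).1 (ha (Submodule.mkQ _ (j x)))
  let h : (κ → R) →ₗ[R] ι → R := (LinearEquiv.ofInjective i hi.injective).symm.toLinearMap ∘ₗ
    LinearMap.codRestrict _ (a • j) hmem
  have hh : i ∘ₗ h = a • j := by
    ext x
    have := LinearEquiv.apply_symm_apply (LinearEquiv.ofInjective i hi.injective)
      (LinearMap.codRestrict _ (a • j) hmem x)
    exact congr_arg Subtype.val this
  refine ⟨a, h, ha0, (injective_iff_map_eq_zero _).2 fun x hx => ?_, hh⟩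
  have h1 : j (a • x) = 0 := by
    rw [map_smul, ← LinearMap.smul_apply, ← hh, LinearMap.comp_apply, hx, map_zero]
  have h2 := (injective_iff_map_eq_zero _).1 hj.injective _ h1
  exact (smul_eq_zero.1 h2).resolve_left ha0

theorem IsFrame.card_le {ι κ : Type*} [Fintype ι] [Fintype κ] {i : (ι → R) →ₗ[R] M}
    {j : (κ → R) →ₗ[R] M} (hi : IsFrame i) (hj : IsFrame j) :
    Fintype.card κ ≤ Fintype.card ι := by
  obtain ⟨_, h, -, hh, -⟩ := hi.exists_smul_eq hj
  exact card_le_of_injective R h hh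

variable [IsNoetherianRing R] [IsIntegrallyClosed R]

/-- An injective endomorphism of a finite free module is a nonsingular matrix. -/
theorem LinearMap.torsionClass_coker_eq_zero {ι : Type*} [Fintype ι]
    (h : (ι → R) →ₗ[R] ι → R) (hh : Function.Injective h) :
    Module.annihilator R ((ι → R) ⧸ LinearMap.range h) ≠ ⊥ ∧
      torsionClass R ((ι → R) ⧸ LinearMap.range h) = 0 := by
  classical
  have hdet : (LinearMap.toMatrix' h).det ≠ 0 := fun h0 => by
    obtain ⟨v, hv, hv0⟩ := Matrix.exists_mulVec_eq_zero_iff.2 h0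
    rw [LinearMap.toMatrix'_mulVec] at hv0
    exact hv ((injective_iff_map_eq_zero _).1 hh v hv0)
  have h1 : (LinearMap.toMatrix' h).mulVecLin = h := by
    rw [← Matrix.toLin'_apply', Matrix.toLin'_toMatrix']
  have h2 := Matrix.annihilator_coker_ne_bot hdet
  have h3 := Matrix.cokerClass_eq_zero hdet
  rw [Matrix.cokerClass, h1] at h3
  rw [h1] at h2
  exact ⟨h2, h3⟩

/-- All frames of a module have cokernels of the same class. -/
theorem IsFrame.torsionClass_coker_eq [Module.Finite R M] {ι κ : Type*} [Fintype ι] [Fintype κ]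
    {i : (ι → R) →ₗ[R] M} {j : (κ → R) →ₗ[R] M} (hi : IsFrame i) (hj : IsFrame j) :
    torsionClass R (M ⧸ LinearMap.range i) = torsionClass R (M ⧸ LinearMap.range j) := by
  let e : (κ → R) ≃ₗ[R] ι → R := LinearEquiv.funCongrLeft R R
    (Fintype.equivOfCardEq (le_antisymm (hj.card_le hi) (hi.card_le hj)))
  have hrange : LinearMap.range (i ∘ₗ e.toLinearMap) = LinearMap.range i := by
    rw [LinearMap.range_comp, LinearEquiv.range, ← LinearMap.range_eq_map]
  obtain ⟨a, h, ha, hh, hij⟩ := (hi.comp_equiv e).exists_smul_eq hj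
  obtain ⟨h1, h2⟩ := LinearMap.torsionClass_coker_eq_zero h hh
  have hs : Function.Injective (a • LinearMap.id : (κ → R) →ₗ[R] κ → R) := fun x y hxy =>
    smul_right_injective _ ha hxy
  obtain ⟨h3, h4⟩ := LinearMap.torsionClass_coker_eq_zero _ hs
  have h5 := torsionClass_coker_comp h _ (hi.comp_equiv e).injective h1
    (hi.comp_equiv e).annihilator_coker_ne_bot
  have h6 := torsionClass_coker_comp _ j hj.injective h3 hj.annihilator_coker_ne_bot
  rw [LinearMap.comp_smul, LinearMap.comp_id, ← hij, h5, h2, h4, zero_add, zero_add, hrange] at h6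
  exact h6

variable (R M) in
/-- The pair of the rank and the first Chern class of a finitely generated module `M`. The latter
is the class in `Cl(R)` of the divisor of the cokernel of any frame of `M`. -/
def rankClass [Module.Finite R M] : ℤ × DivisorClassGroup R :=
  (((exists_isFrame (R := R) (M := M)).choose : ℤ),
    torsionClass R (M ⧸ LinearMap.range (exists_isFrame (R := R) (M := M)).choose_spec.choose))

theorem IsFrame.rankClass_eq [Module.Finite R M] {ι : Type*} [Fintype ι]
    {i : (ι → R) →ₗ[R] M} (hi : IsFrame i) :
    rankClass R M = ((Fintype.card ι : ℤ), torsionClass R (M ⧸ LinearMap.range i)) := by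
  have hj := (exists_isFrame (R := R) (M := M)).choose_spec.choose_spec
  have hcard := le_antisymm (hi.card_le hj) (hj.card_le hi)
  rw [Fintype.card_fin] at hcard
  rw [rankClass, hj.torsionClass_coker_eq hi, hcard]

theorem rankClass_of_exact [Module.Finite R M] [Module.Finite R M'] [Module.Finite R M'']
    (f : M' →ₗ[R] M) (g : M →ₗ[R] M'') (hf : Function.Injective f) (hfg : Function.Exact f g)
    (hg : Function.Surjective g) : rankClass R M = rankClass R M' + rankClass R M'' := by
  obtain ⟨r, i, hi⟩ := exists_isFrame (R := R) (M := M')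
  obtain ⟨r', i', hi'⟩ := exists_isFrame (R := R) (M := M'')
  obtain ⟨j, hj, F, G, hF, hFG, hG⟩ := hi.exists_of_exact f g hf hfg hg hi'
  rw [hi.rankClass_eq, hi'.rankClass_eq, hj.rankClass_eq,
    torsionClass_of_exact hj.annihilator_coker_ne_bot F G hF hFG hG]
  simp

theorem rankClass_of_annihilator_ne_bot [Module.Finite R M] (h : Module.annihilator R M ≠ ⊥) :
    rankClass R M = (0, torsionClass R M) := by
  rw [(isFrame_zero_of_annihilator_ne_bot h).rankClass_eq,
    torsionClass_congr (Submodule.quotEquivOfEqBot _ LinearMap.range_zero)]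
  simp

variable (R) in
theorem rankClass_self : rankClass R R = (1, 0) := by
  have h := isFrame_of_linearEquiv (LinearEquiv.funUnique (Fin 1) R R)
  have : Subsingleton (R ⧸ LinearMap.range (LinearEquiv.funUnique (Fin 1) R R).toLinearMap) :=
    Submodule.Quotient.subsingleton_iff.2 (LinearEquiv.range _)
  rw [h.rankClass_eq, torsionClass_of_subsingleton]
  simp

end RankClass

/-! ### The Grothendieck group -/

namespace G0

variable (R : Type) [CommRing R]

/-- The class of a finitely generated module in `G₀(R)`. -/
def of (M : Type) [AddCommGroup M] [Module R M] [Module.Finite R M] : G0 R :=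
  QuotientAddGroup.mk (FreeAbelianGroup.of (FGModuleCat.of R M))

variable {R}
variable {M M' M'' : Type} [AddCommGroup M] [Module R M] [AddCommGroup M'] [Module R M']
  [AddCommGroup M''] [Module R M''] [Module.Finite R M] [Module.Finite R M'] [Module.Finite R M'']

theorem of_exact (f : M' →ₗ[R] M) (g : M →ₗ[R] M'') (hf : Function.Injective f)
    (hfg : Function.Exact f g) (hg : Function.Surjective g) :
    of R M = of R M' + of R M'' := by
  rw [← sub_eq_zero]
  exact (QuotientAddGroup.eq_zero_iff _).2 (AddSubgroup.subset_closure
    ⟨FGModuleCat.of R M', FGModuleCat.of R M, FGModuleCat.of R M'', f, g, hf, hfg, hg, rfl⟩)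

theorem of_subsingleton [Subsingleton M] : of R M = 0 := by
  have h := of_exact (R := R) (0 : M →ₗ[R] M) (0 : M →ₗ[R] M)
    (Function.injective_of_subsingleton _)
    (fun x => ⟨fun _ => ⟨0, Subsingleton.elim _ _⟩, fun _ => Subsingleton.elim _ _⟩)
    (Function.surjective_to_subsingleton _)
  exact left_eq_add.1 h

theorem of_congr (e : M ≃ₗ[R] M') : of R M = of R M' := by
  have h := of_exact e.toLinearMap (0 : M' →ₗ[R] PUnit) e.injective
    ((LinearMap.exact_zero_iff_surjective _ _).2 e.surjective)
    (Function.surjective_to_subsingleton _)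
  rw [of_subsingleton (M := PUnit), add_zero] at h
  exact h.symm

/-- A map on modules which is additive on short exact sequences induces a map on `G₀`. -/
def lift {X : Type*} [AddCommGroup X] (φ : FGModuleCat.{0} R → X)
    (hφ : ∀ (M' M M'' : FGModuleCat.{0} R) (f : M' →ₗ[R] M) (g : M →ₗ[R] M''),
      Function.Injective f → Function.Exact f g → Function.Surjective g → φ M = φ M' + φ M'') :
    G0 R →+ X :=
  QuotientAddGroup.lift _ (FreeAbelianGroup.lift φ) ((AddSubgroup.closure_le _).2 (by
    rintro _ ⟨M', M, M'', f, g, hf, hfg, hg, rfl⟩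
    change FreeAbelianGroup.lift φ _ = 0
    simp [hφ M' M M'' f g hf hfg hg]))

theorem closure_range_of (H : AddSubgroup (G0 R))
    (h : ∀ (M : Type) [AddCommGroup M] [Module R M] [Module.Finite R M], of R M ∈ H) (x : G0 R) :
    x ∈ H := by
  obtain ⟨x, rfl⟩ := QuotientAddGroup.mk_surjective x
  induction x using FreeAbelianGroup.induction_on with
  | zero => exact H.zero_mem
  | of M => exact h M
  | neg M hM => exact H.neg_mem hM
  | add x y hx hy => exact H.add_mem hx hy

/-- If `B` is a domain and a quotient of `R` and `b ∈ B` is nonzero, then `R ⧸ e⁻¹(b)` is the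
cokernel of multiplication by `b` on `B`, hence has class zero. -/
theorem of_quotient_comap_span_singleton {B : Type} [CommRing B] [IsDomain B] (e : R →+* B)
    (he : Function.Surjective e) {b : B} (hb : b ≠ 0) :
    of R (R ⧸ (Ideal.span {b}).comap e) = 0 := by
  algebraize [e]
  have : Module.Finite R B := Module.Finite.of_surjective (Algebra.linearMap R B) he
  let g : B →ₗ[R] B ⧸ Ideal.span {b} := (Ideal.Quotient.mkₐ R (Ideal.span {b})).toLinearMap
  have hg : Function.Surjective g := Ideal.Quotient.mk_surjective
  have : Module.Finite R (B ⧸ Ideal.span {b}) := Module.Finite.of_surjective g hg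
  have h1 := of_exact (LinearMap.mulLeft R b) g (mul_right_injective₀ hb) (fun x => by
    change Ideal.Quotient.mk _ x = 0 ↔ _
    rw [Ideal.Quotient.eq_zero_iff_mem, Ideal.mem_span_singleton]
    exact exists_congr fun y => eq_comm) hg
  let q : R →ₗ[R] B ⧸ Ideal.span {b} := g ∘ₗ Algebra.linearMap R B
  have hq : LinearMap.ker q = (Ideal.span {b}).comap e := by
    ext x
    exact Ideal.Quotient.eq_zero_iff_mem
  rw [of_congr ((Submodule.quotEquivOfEq _ _ hq.symm).trans
    (q.quotKerEquivOfSurjective (hg.comp he)))]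
  exact left_eq_add.1 (h1.trans (add_comm _ _) |>.trans (add_comm _ _))

variable (R) in
/-- The homomorphism from Weil divisors to `G₀(R)` with `p ↦ [R ⧸ p]`. -/
def ofDivisor : WeilDivisor R →+ G0 R :=
  Finsupp.liftAddHom fun p => zmultiplesHom (G0 R) (of R (R ⧸ p.1.asIdeal))

theorem ofDivisor_single (p : HeightOnePrime R) (n : ℤ) :
    ofDivisor R (Finsupp.single p n) = n • of R (R ⧸ p.1.asIdeal) := by
  simp [ofDivisor]

section Domain

variable [IsDomain R] [IsNoetherianRing R]

/-- If the classes `[R ⧸ q]` for primes `q` of height at least two vanish, the class of a torsion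
module is determined by its divisor. -/
theorem ofDivisor_lengthDivisor
    (h0 : ∀ q : Ideal R, q.IsPrime → q ≠ ⊥ → q.height ≠ 1 → of R (R ⧸ q) = 0)
    (h : Module.annihilator R M ≠ ⊥) : ofDivisor R (lengthDivisor R M) = of R M := by
  induction ‹Module.Finite R M› using
    IsNoetherianRing.induction_on_isQuotientEquivQuotientPrime R with
  | subsingleton N => rw [lengthDivisor_of_subsingleton, map_zero, of_subsingleton]
  | quotient N q e =>
    rw [e.annihilator_eq, Ideal.annihilator_quotient] at h
    rw [lengthDivisor_congr e, of_congr e]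
    by_cases hq : q.1.height = 1
    · exact (congr_arg (ofDivisor R) (lengthDivisor_quotient_self ⟨q, hq⟩)).trans
        ((ofDivisor_single _ 1).trans (one_smul _ _))
    · rw [lengthDivisor_quotient_of_height_ne_one q.1 h hq, map_zero, h0 q.1 q.2 h hq]
  | exact N₁ N₂ N₃ f g hf hg hfg h₁ h₃ =>
    rw [lengthDivisor_of_exact h f g hf hfg hg, map_add, of_exact f g hf hfg hg,
      h₁ (ne_bot_of_le_ne_bot h (f.annihilator_le_of_injective hf)),
      h₃ (ne_bot_of_le_ne_bot h (g.annihilator_le_of_surjective hg))]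

variable [IsIntegrallyClosed R]

theorem ofDivisor_div
    (h0 : ∀ q : Ideal R, q.IsPrime → q ≠ ⊥ → q.height ≠ 1 → of R (R ⧸ q) = 0)
    (x : Additive (FractionRing R)ˣ) : ofDivisor R (WeilDivisor.div R x) = 0 := by
  have key : ∀ (a : R) (y : (FractionRing R)ˣ), a ≠ 0 → (y : FractionRing R) = algebraMap R _ a →
      ofDivisor R (WeilDivisor.div R (Additive.ofMul y)) = 0 := fun a y ha hy => by
    rw [← lengthDivisor_quotient_span_singleton ha y hy, ofDivisor_lengthDivisor h0]
    · exact of_quotient_comap_span_singleton (RingHom.id R) Function.surjective_id ha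
    · rwa [Ideal.annihilator_quotient, Ne, Ideal.span_singleton_eq_bot]
  obtain ⟨a, b, hb, hab⟩ := IsFractionRing.div_surjective (A := R) (x.toMul : FractionRing R)
  have hb0 : b ≠ 0 := nonZeroDivisors.ne_zero hb
  have hbK : algebraMap R (FractionRing R) b ≠ 0 := by simpa using hb0
  have ha0 : a ≠ 0 := by
    rintro rfl
    rw [map_zero, zero_div] at hab
    exact x.toMul.ne_zero hab.symm
  have haK : algebraMap R (FractionRing R) a ≠ 0 := by simpa using ha0
  have hx : x = Additive.ofMul (Units.mk0 _ haK) - Additive.ofMul (Units.mk0 _ hbK) := by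
    rw [← ofMul_div, ← ofMul_toMul x]
    exact congr_arg _ (Units.ext (by rw [← hab]; simp))
  rw [hx, map_sub, map_sub, key a _ ha0 rfl, key b _ hb0 rfl, sub_zero]

variable (R) in
/-- The homomorphism `G₀(R) → ℤ ⊕ Cl(R)` given by the rank and the first Chern class. -/
def rankClassHom : G0 R →+ ℤ × DivisorClassGroup R :=
  lift (fun M => rankClass R M) fun _ _ _ f g hf hfg hg => rankClass_of_exact f g hf hfg hg

theorem rankClassHom_of : rankClassHom R (of R M) = rankClass R M := by
  simp [rankClassHom, lift, of]

/-- The homomorphism `ℤ ⊕ Cl(R) → G₀(R)` with `(1, 0) ↦ [R]` and `(0, p) ↦ [R ⧸ p]`. -/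
def ofRankClass (h0 : ∀ q : Ideal R, q.IsPrime → q ≠ ⊥ → q.height ≠ 1 → of R (R ⧸ q) = 0) :
    ℤ × DivisorClassGroup R →+ G0 R :=
  (zmultiplesHom (G0 R) (of R R)).coprod (QuotientAddGroup.lift _ (ofDivisor R) (by
    rintro _ ⟨x, rfl⟩
    exact ofDivisor_div h0 x))

/-- The Grothendieck group of a normal noetherian domain in which the classes of all primes of
height at least two vanish. -/
theorem nonempty_equiv
    (h0 : ∀ q : Ideal R, q.IsPrime → q ≠ ⊥ → q.height ≠ 1 → of R (R ⧸ q) = 0) :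
    Nonempty (G0 R ≃+ ℤ × DivisorClassGroup R) := by
  have hZ : ∀ n : ℤ, ofRankClass h0 (n, 0) = n • of R R := fun n => by simp [ofRankClass]
  have hD : ∀ D : WeilDivisor R,
      ofRankClass h0 (0, (QuotientAddGroup.mk D : DivisorClassGroup R)) = ofDivisor R D :=
    fun D => by
      simp only [ofRankClass, AddMonoidHom.coprod_apply, map_zero, zero_add]
      rfl
  have hsurj : Function.Surjective (ofRankClass h0) := by
    intro x
    refine closure_range_of (ofRankClass h0).range (fun M _ _ _ => ?_) x
    induction ‹Module.Finite R M› using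
      IsNoetherianRing.induction_on_isQuotientEquivQuotientPrime R with
    | subsingleton N =>
      rw [of_subsingleton]
      exact AddSubgroup.zero_mem _
    | quotient N q e =>
      by_cases hq : q.1 = ⊥
      · exact ⟨(1, 0), by rw [hZ, one_smul, of_congr e,
          of_congr (Submodule.quotEquivOfEqBot q.1 hq)]⟩
      · exact ⟨_, (hD _).trans (ofDivisor_lengthDivisor h0 (by
          rwa [e.annihilator_eq, Ideal.annihilator_quotient]))⟩
    | exact N₁ N₂ N₃ f g hf hg hfg h₁ h₃ =>
      rw [of_exact f g hf hfg hg]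
      exact AddSubgroup.add_mem _ h₁ h₃
  have hD' : ∀ D : WeilDivisor R, rankClassHom R (ofDivisor R D) =
      (0, (QuotientAddGroup.mk D : DivisorClassGroup R)) := by
    refine DFunLike.congr_fun (f := (rankClassHom R).comp (ofDivisor R))
      (g := (AddMonoidHom.inr ℤ (DivisorClassGroup R)).comp
        (QuotientAddGroup.mk' (WeilDivisor.div R).range)) ?_
    refine Finsupp.addHom_ext' fun p => AddMonoidHom.ext_int ?_
    change rankClassHom R (ofDivisor R (Finsupp.single p 1)) = (0, QuotientAddGroup.mk _)
    rw [ofDivisor_single, one_smul, rankClassHom_of, rankClass_of_annihilator_ne_bot,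
      torsionClass, lengthDivisor_quotient_self]
    · rfl
    · rw [Ideal.annihilator_quotient]
      exact Ideal.ne_bot_of_height_eq_one p.2
  have hleft : Function.LeftInverse (rankClassHom R) (ofRankClass h0) := by
    rintro ⟨n, c⟩
    obtain ⟨D, rfl⟩ := QuotientAddGroup.mk_surjective c
    have : ((n, QuotientAddGroup.mk D) : ℤ × DivisorClassGroup R) =
      (n, 0) + (0, QuotientAddGroup.mk D) := by simp
    rw [this, map_add, map_add, hZ, hD, hD', map_zsmul, rankClassHom_of, rankClass_self]
    simp
  exact ⟨(AddEquiv.ofBijective (ofRankClass h0) ⟨hleft.injective, hsurj⟩).symm⟩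

end Domain

end G0

/-! ### Normality from two localisations -/

section Normality

open scoped nonZeroDivisors

/-- If `S` becomes equal to a localisation of a normal domain `P` after inverting `φ w`, an element
integral over `S` lies in `S[1 / φ w]`. -/
theorem exists_mul_pow_eq_of_isIntegral {P S : Type*} [CommRing P] [IsDomain P]
    [IsIntegrallyClosed P] [CommRing S] [IsDomain S] (φ : P →+* S) (hφ : Function.Injective φ)
    (w : P) (hw : w ≠ 0) (h : ∀ s, ∃ (k : ℕ) (p : P), s * φ w ^ k = φ p)
    {z : FractionRing S} (hz : IsIntegral S z) :
    ∃ (k : ℕ) (s : S), z * algebraMap S (FractionRing S) (φ w) ^ k = algebraMap S _ s := by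
  have hw' : φ w ≠ 0 := (map_ne_zero_iff φ hφ).2 hw
  have hle : Submonoid.powers (φ w) ≤ S⁰ := powers_le_nonZeroDivisors_of_noZeroDivisors hw'
  let T := Localization.Away (φ w)
  have hT : IsDomain T := IsLocalization.isDomain_localization hle
  have hST : Function.Injective (algebraMap S T) := IsLocalization.injective T hle
  let : Algebra P T := ((algebraMap S T).comp φ).toAlgebra
  have halg : ∀ p, algebraMap P T p = algebraMap S T (φ p) := fun p => rfl
  have hloc : IsLocalization.Away w T := by
    refine IsLocalization.Away.mk w (IsLocalization.Away.algebraMap_isUnit (φ w)) (fun x => ?_)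
      fun p q hpq => ⟨0, by rw [hφ (hST hpq)]⟩
    obtain ⟨k, s, hs⟩ := IsLocalization.Away.surj (φ w) x
    obtain ⟨l, p, hp⟩ := h s
    refine ⟨k + l, p, ?_⟩
    rw [halg, halg, pow_add, ← mul_assoc, hs, ← map_pow, ← map_mul, hp]
  have hTn : IsIntegrallyClosed T := isIntegrallyClosed_of_isLocalization T (Submonoid.powers w)
    (powers_le_nonZeroDivisors_of_noZeroDivisors hw)
  let : Algebra T (FractionRing S) :=
    IsLocalization.localizationAlgebraOfSubmonoidLe T (FractionRing S) (Submonoid.powers (φ w)) S⁰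
      hle
  have : IsScalarTower S T (FractionRing S) :=
    IsLocalization.localization_isScalarTower_of_submonoid_le T (FractionRing S)
      (Submonoid.powers (φ w)) S⁰ hle
  have : IsFractionRing T (FractionRing S) :=
    IsFractionRing.isFractionRing_of_isDomain_of_isLocalization (Submonoid.powers (φ w)) T _
  obtain ⟨y, rfl⟩ := (isIntegrallyClosed_iff (FractionRing S)).1 hTn (hz.tower_top (A := T))
  obtain ⟨k, s, hs⟩ := IsLocalization.Away.surj (φ w) y
  refine ⟨k, s, ?_⟩
  rw [IsScalarTower.algebraMap_apply S T (FractionRing S),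
    IsScalarTower.algebraMap_apply S T (FractionRing S), ← map_pow, ← map_mul, hs]

/-- If `u` is a nonzerodivisor modulo `v`, then `S = S[1/u] ∩ S[1/v]`. -/
theorem exists_algebraMap_eq_of_mul_pow_eq {S : Type*} [CommRing S] [IsDomain S] {u v : S}
    (hv : v ≠ 0) (huv : ∀ s, v ∣ u * s → v ∣ s) {z : FractionRing S}
    (hzu : ∃ (k : ℕ) (s : S), z * algebraMap S (FractionRing S) u ^ k = algebraMap S _ s)
    (hzv : ∃ (k : ℕ) (s : S), z * algebraMap S (FractionRing S) v ^ k = algebraMap S _ s) :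
    ∃ s, algebraMap S (FractionRing S) s = z := by
  have hinj : Function.Injective (algebraMap S (FractionRing S)) :=
    IsFractionRing.injective S (FractionRing S)
  obtain ⟨l, b, hb⟩ := hzu
  obtain ⟨k, s, hs⟩ := hzv
  have hul : ∀ (l : ℕ) (s : S), v ∣ u ^ l * s → v ∣ s := fun l => by
    induction l with
    | zero => simp
    | succ l ih => exact fun s hs => ih s (huv _ (by rwa [← mul_assoc, ← pow_succ']))
  induction k generalizing s with
  | zero => exact ⟨s, by rw [← hs, pow_zero, mul_one]⟩
  | succ k ih =>
    have h1 : u ^ l * s = v * (v ^ k * b) := hinj (by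
      rw [map_mul, map_mul, map_mul, map_pow, map_pow, ← hs, ← hb]
      ring)
    obtain ⟨s', rfl⟩ := hul l s ⟨_, h1⟩
    refine ih s' (mul_left_cancel₀ ((map_ne_zero_iff _ hinj).2 hv) ?_)
    rw [← map_mul, ← hs]
    ring

end Normality

/-! ### The rings `ℂ[u, v, x₁, …, xₙ] / (u v - g)` -/

namespace ViehwegRing

open MvPolynomial

variable {n t : ℕ} (f : Fin t → MvPolynomial (Fin n) ℂ) (a : Fin t → ℕ)

/-- The map `ℂ[x₁, …, xₙ] → A`. -/
def base : MvPolynomial (Fin n) ℂ →+* ViehwegRing f a :=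
  (Ideal.Quotient.mk _).comp (rename Sum.inr : _ →ₐ[ℂ] MvPolynomial (Fin 2 ⊕ Fin n) ℂ).toRingHom

/-- The classes of `u` (for `i = 0`) and `v` (for `i = 1`) in `A`. -/
def coord (i : Fin 2) : ViehwegRing f a := Ideal.Quotient.mk _ (X (Sum.inl i))

theorem coord_zero_mul_coord_one :
    coord f a 0 * coord f a 1 = base f a (∏ i, f i ^ a i) := by
  rw [coord, coord, ← map_mul]
  exact Ideal.Quotient.eq.2 (Ideal.mem_span_singleton_self (viehwegPoly f a))

theorem coord_mul_coord_one_sub (i : Fin 2) :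
    coord f a i * coord f a (1 - i) = base f a (∏ i, f i ^ a i) := by
  fin_cases i
  · exact coord_zero_mul_coord_one f a
  · exact (mul_comm _ _).trans (coord_zero_mul_coord_one f a)

variable {f a}

theorem induction {C : ViehwegRing f a → Prop} (hbase : ∀ p, C (base f a p))
    (hcoord : ∀ i, C (coord f a i)) (hadd : ∀ x y, C x → C y → C (x + y))
    (hmul : ∀ x y, C x → C y → C (x * y)) (x : ViehwegRing f a) : C x := by
  obtain ⟨x, rfl⟩ := Ideal.Quotient.mk_surjective x
  induction x using MvPolynomial.induction_on with
  | C c =>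
    have h := hbase (MvPolynomial.C c)
    simpa [base] using h
  | add p q hp hq =>
    rw [map_add]
    exact hadd _ _ hp hq
  | mul_X p k hp =>
    rw [map_mul]
    refine hmul _ _ hp ?_
    rcases k with i | j
    · exact hcoord i
    · have h := hbase (X j)
      simpa [base] using h

theorem ringHom_ext {B : Type*} [CommRing B] {φ ψ : ViehwegRing f a →+* B}
    (hbase : φ.comp (base f a) = ψ.comp (base f a))
    (hcoord : ∀ i, φ (coord f a i) = ψ (coord f a i)) : φ = ψ :=
  RingHom.ext fun x => by
    induction x using induction with
    | hbase p => exact RingHom.congr_fun hbase p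
    | hcoord i => exact hcoord i
    | hadd x y hx hy => rw [map_add, map_add, hx, hy]
    | hmul x y hx hy => rw [map_mul, map_mul, hx, hy]

variable (f a)

/-- The homomorphism out of `A` given by a homomorphism on `ℂ[x₁, …, xₙ]` and images of `u` and
`v` satisfying the defining equation. -/
def lift {B : Type*} [CommRing B] (β : MvPolynomial (Fin n) ℂ →+* B) (w : Fin 2 → B)
    (h : w 0 * w 1 = β (∏ i, f i ^ a i)) : ViehwegRing f a →+* B :=
  Ideal.Quotient.lift _ (eval₂Hom (β.comp C) (Sum.elim w fun j => β (X j))) (by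
    have hβ : (eval₂Hom (β.comp C) (Sum.elim w fun j => β (X j))).comp
        (rename Sum.inr : _ →ₐ[ℂ] MvPolynomial (Fin 2 ⊕ Fin n) ℂ).toRingHom = β := by
      ext <;> simp
    intro x hx
    obtain ⟨y, rfl⟩ := Ideal.mem_span_singleton.1 hx
    have hg : eval₂Hom (β.comp C) (Sum.elim w fun j => β (X j))
        (rename Sum.inr (∏ i, f i ^ a i)) = β (∏ i, f i ^ a i) := RingHom.congr_fun hβ _
    rw [map_mul, viehwegPoly, map_sub, map_mul, hg]
    simp [h])

section lift

variable {f a} {B : Type*} [CommRing B] (β : MvPolynomial (Fin n) ℂ →+* B) (w : Fin 2 → B)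
    (h : w 0 * w 1 = β (∏ i, f i ^ a i))

@[simp]
theorem lift_base (p : MvPolynomial (Fin n) ℂ) : lift f a β w h (base f a p) = β p := by
  have hβ : (lift f a β w h).comp (base f a) = β := by
    ext <;> simp [lift, base]
  exact RingHom.congr_fun hβ p

@[simp]
theorem lift_coord (i : Fin 2) : lift f a β w h (coord f a i) = w i := by
  simp [lift, coord]

end lift

/-- The map `ℂ[x₁, …, xₙ][y] → A` sending `y` to `u` or `v`. -/
def ofPoly (i : Fin 2) : Polynomial (MvPolynomial (Fin n) ℂ) →+* ViehwegRing f a :=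
  Polynomial.eval₂RingHom (base f a) (coord f a i)

@[simp]
theorem ofPoly_C (i : Fin 2) (p : MvPolynomial (Fin n) ℂ) :
    ofPoly f a i (Polynomial.C p) = base f a p := by
  simp [ofPoly]

@[simp]
theorem ofPoly_X (i : Fin 2) : ofPoly f a i Polynomial.X = coord f a i := by
  simp [ofPoly]

/-- Sending the other coordinate to `g / y` maps `A` to the fraction field of `ℂ[x₁, …, xₙ][y]`. -/
theorem ofPoly_injective (i : Fin 2) : Function.Injective (ofPoly f a i) := by
  let K := FractionRing (Polynomial (MvPolynomial (Fin n) ℂ))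
  let ι := algebraMap (Polynomial (MvPolynomial (Fin n) ℂ)) K
  have hι : Function.Injective ι := IsFractionRing.injective _ K
  have hX : ι Polynomial.X ≠ 0 := (map_ne_zero_iff ι hι).2 Polynomial.X_ne_zero
  let w : Fin 2 → K := fun j => if j = i then ι Polynomial.X else
    ι (Polynomial.C (∏ i, f i ^ a i)) / ι Polynomial.X
  have hw : w 0 * w 1 = (ι.comp Polynomial.C) (∏ i, f i ^ a i) := by
    fin_cases i
    · simp only [w, RingHom.comp_apply]
      simp [mul_div_cancel₀ _ hX]
    · simp only [w, RingHom.comp_apply]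
      simp [div_mul_cancel₀ _ hX]
  have hcomp : (lift f a (ι.comp Polynomial.C) w hw).comp (ofPoly f a i) = ι := by
    refine Polynomial.ringHom_ext (fun p => ?_) ?_
    · simp
    · simp [w]
  refine Function.Injective.of_comp (f := lift f a (ι.comp Polynomial.C) w hw) ?_
  rw [← RingHom.coe_comp, hcomp]
  exact hι

/-- After inverting one of `u` and `v`, the ring `A` is a localisation of a polynomial ring. -/
theorem exists_mul_coord_pow_eq (i : Fin 2) (s : ViehwegRing f a) :
    ∃ (k : ℕ) (p : Polynomial (MvPolynomial (Fin n) ℂ)),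
      s * ofPoly f a i Polynomial.X ^ k = ofPoly f a i p := by
  induction s using induction with
  | hbase p => exact ⟨0, Polynomial.C p, by simp⟩
  | hcoord j =>
    by_cases hj : j = i
    · subst hj
      exact ⟨0, Polynomial.X, by simp⟩
    · refine ⟨1, Polynomial.C (∏ i, f i ^ a i), ?_⟩
      have hj' : j = 1 - i := by
        revert hj
        revert i j
        decide
      rw [ofPoly_X, ofPoly_C, pow_one, hj', mul_comm, coord_mul_coord_one_sub]
  | hadd x y hx hy =>
    obtain ⟨k, p, hp⟩ := hx
    obtain ⟨l, q, hq⟩ := hy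
    refine ⟨k + l, p * Polynomial.X ^ l + q * Polynomial.X ^ k, ?_⟩
    rw [map_add, map_mul, map_mul, ← hp, ← hq, map_pow, map_pow]
    ring
  | hmul x y hx hy =>
    obtain ⟨k, p, hp⟩ := hx
    obtain ⟨l, q, hq⟩ := hy
    refine ⟨k + l, p * q, ?_⟩
    rw [map_mul, ← hp, ← hq]
    ring

theorem exists_eq_ofPoly_add (s : ViehwegRing f a) :
    ∃ (p : Polynomial (MvPolynomial (Fin n) ℂ)) (s' : ViehwegRing f a),
      s = ofPoly f a 0 p + coord f a 1 * s' := by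
  induction s using induction with
  | hbase p => exact ⟨Polynomial.C p, 0, by simp⟩
  | hcoord j =>
    fin_cases j
    · exact ⟨Polynomial.X, 0, by simp⟩
    · exact ⟨0, 1, by simp⟩
  | hadd x y hx hy =>
    obtain ⟨p, s, rfl⟩ := hx
    obtain ⟨q, r, rfl⟩ := hy
    exact ⟨p + q, s + r, by rw [map_add]; ring⟩
  | hmul x y hx hy =>
    obtain ⟨p, s, rfl⟩ := hx
    obtain ⟨q, r, rfl⟩ := hy
    exact ⟨p * q, ofPoly f a 0 p * r + s * ofPoly f a 0 q + coord f a 1 * s * r, by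
      rw [map_mul]; ring⟩

/-- As `A / (v) = (ℂ[x₁, …, xₙ] / (g))[u]`, the element `u` is a nonzerodivisor modulo `v`. -/
theorem coord_one_dvd_of_dvd_mul (s : ViehwegRing f a)
    (h : coord f a 1 ∣ coord f a 0 * s) : coord f a 1 ∣ s := by
  let g := ∏ i, f i ^ a i
  let π := Ideal.Quotient.mk (Ideal.span {g})
  let w : Fin 2 → Polynomial (MvPolynomial (Fin n) ℂ ⧸ Ideal.span {g}) := ![Polynomial.X, 0]
  have hw : w 0 * w 1 = (Polynomial.C.comp π) g := by
    have : π g = 0 := Ideal.Quotient.eq_zero_iff_mem.2 (Ideal.mem_span_singleton_self g)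
    rw [RingHom.comp_apply, this]
    simp [w]
  let F := lift f a (Polynomial.C.comp π) w hw
  obtain ⟨p, s', rfl⟩ := exists_eq_ofPoly_add f a s
  refine dvd_add ?_ (dvd_mul_right _ _)
  have hF0 : F (coord f a 0) = Polynomial.X := by simp [F, w]
  have hF1 : F (coord f a 1) = 0 := by simp [F, w]
  have hFp : F.comp (ofPoly f a 0) = Polynomial.mapRingHom π :=
    Polynomial.ringHom_ext (fun p => by simp [F]) (by simp [F, w])
  obtain ⟨r, hr⟩ := h
  have h1 := congr_arg F hr
  rw [map_mul, map_add, map_mul, map_mul, hF0, hF1, zero_mul, zero_mul, add_zero,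
    Polynomial.X_mul] at h1
  have h2 : p.map π = 0 := (RingHom.congr_fun hFp p).symm.trans
    (mul_right_mem_nonZeroDivisors_eq_zero_iff Polynomial.X_mem_nonzeroDivisors |>.1 h1)
  have h3 : Polynomial.C g ∣ p := Polynomial.C_dvd_iff_dvd_coeff _ _ |>.2 fun k => by
    have h4 := congr_arg (fun q => Polynomial.coeff q k) h2
    simp only [Polynomial.coeff_map, Polynomial.coeff_zero] at h4
    exact Ideal.mem_span_singleton.1 (Ideal.Quotient.eq_zero_iff_mem.1 h4)
  obtain ⟨q, rfl⟩ := h3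
  rw [map_mul, ofPoly_C, ← coord_zero_mul_coord_one]
  exact Dvd.intro_left _ (by ring : coord f a 0 * ofPoly f a 0 q * coord f a 1 = _)

variable {f a}

theorem irreducible_viehwegPoly (hg : ∏ i, f i ^ a i ≠ 0) : Irreducible (viehwegPoly f a) := by
  classical
  have hvars : ∀ i : Fin 2, Sum.inl i ∉
      (-rename Sum.inr (∏ i, f i ^ a i) : MvPolynomial (Fin 2 ⊕ Fin n) ℂ).vars := fun i hi => by
    rw [vars_neg] at hi
    simpa using vars_rename _ _ hi
  rw [viehwegPoly, sub_eq_add_neg]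
  refine irreducible_mul_X_add _ _ _ (X_ne_zero _) (by simp) (hvars 1) ?_
  rw [X_prime.irreducible.isRelPrime_iff_not_dvd]
  rintro ⟨q, hq⟩
  have h := congr_arg (aeval (Sum.elim 0 X : Fin 2 ⊕ Fin n → MvPolynomial (Fin n) ℂ)) hq
  rw [map_neg, aeval_rename, map_mul, aeval_X, Sum.elim_comp_inr, aeval_X_left] at h
  exact hg (by simpa using h)

theorem isDomain (hg : ∏ i, f i ^ a i ≠ 0) : IsDomain (ViehwegRing f a) := by
  have h := irreducible_viehwegPoly hg
  have : (Ideal.span {viehwegPoly f a}).IsPrime :=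
    (Ideal.span_singleton_prime h.ne_zero).2 h.prime
  exact Ideal.Quotient.isDomain _

theorem isIntegrallyClosed (hg : ∏ i, f i ^ a i ≠ 0) : IsIntegrallyClosed (ViehwegRing f a) := by
  have := isDomain hg
  have hint := fun i z hz => exists_mul_pow_eq_of_isIntegral (ofPoly f a i)
    (ofPoly_injective f a i) Polynomial.X Polynomial.X_ne_zero (exists_mul_coord_pow_eq f a i)
    (z := z) hz
  simp only [ofPoly_X] at hint
  have hne : ∀ i, coord f a i ≠ 0 := fun i => by
    rw [← ofPoly_X]
    exact (map_ne_zero_iff _ (ofPoly_injective f a i)).2 Polynomial.X_ne_zero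
  exact (isIntegrallyClosed_iff (FractionRing (ViehwegRing f a))).2 fun {z} hz =>
    exists_algebraMap_eq_of_mul_pow_eq (hne 1) (coord_one_dvd_of_dvd_mul f a)
      (hint 0 z hz) (hint 1 z hz)

theorem eq_one_of_ringKrullDim_eq_two (hg : ∏ i, f i ^ a i ≠ 0)
    (hdim : ringKrullDim (ViehwegRing f a) = 2) : n = 1 := by
  have := isDomain hg
  have hupper := ringKrullDim_quotient_succ_le_of_nonZeroDivisor
    (mem_nonZeroDivisors_of_ne_zero (irreducible_viehwegPoly hg).ne_zero)
  -- Setting `u = 1` gives a surjection `A → ℂ[x₁, …, xₙ]` with nonzero kernel.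
  let e : ViehwegRing f a →+* MvPolynomial (Fin n) ℂ :=
    lift f a (RingHom.id _) ![1, ∏ i, f i ^ a i] (by simp)
  let e' : ViehwegRing f a →+* MvPolynomial (Fin n) ℂ :=
    lift f a (RingHom.id _) ![-1, -∏ i, f i ^ a i] (by simp)
  have hne : coord f a 0 - 1 ≠ 0 := fun h => by
    have := congr_arg e' h
    simp only [map_sub, map_one, map_zero, e', lift_coord, Matrix.cons_val_zero] at this
    norm_num at this
  have hlower := ringKrullDim_succ_le_of_surjective e (fun p => ⟨base f a p, by simp [e]⟩)
    (mem_nonZeroDivisors_of_ne_zero hne) (by simp [e])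
  change ringKrullDim (ViehwegRing f a) + 1 ≤ _ at hupper
  rw [hdim, ringKrullDim_of_isNoetherianRing, ringKrullDim_eq_zero_of_field,
    Nat.card_eq_fintype_card, zero_add] at hupper hlower
  simp only [Fintype.card_sum, Fintype.card_fin] at hupper hlower
  have h1 : 3 ≤ 2 + n := by exact_mod_cast hupper
  have h2 : n + 1 ≤ 2 := by exact_mod_cast hlower
  omega

/-- The homomorphism `A → ℂ` of evaluation at a point of the hypersurface `u v = g`. -/
def evalHom (w : Fin 2 → ℂ) (x : Fin n → ℂ) (h : w 0 * w 1 = eval x (∏ i, f i ^ a i)) :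
    ViehwegRing f a →+* ℂ :=
  lift f a (eval x) w h

/-- By the Nullstellensatz, maximal ideals are points. -/
theorem exists_eq_ker_evalHom (m : Ideal (ViehwegRing f a)) [m.IsMaximal] :
    ∃ (w : Fin 2 → ℂ) (x : Fin n → ℂ) (h : w 0 * w 1 = eval x (∏ i, f i ^ a i)),
      m = RingHom.ker (evalHom w x h) := by
  let q := Ideal.Quotient.mk (Ideal.span {viehwegPoly f a})
  have hq : Function.Surjective q := Ideal.Quotient.mk_surjective
  have hmax : (m.comap q).IsMaximal := Ideal.comap_isMaximal_of_surjective q hq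
  obtain ⟨y, hy⟩ : ∃ y, m.comap q = vanishingIdeal ℂ {y} :=
    isMaximal_iff_eq_vanishingIdeal_singleton.1 hmax
  have hmem : viehwegPoly f a ∈ m.comap q := by
    have : q (viehwegPoly f a) = 0 :=
      Ideal.Quotient.eq_zero_iff_mem.2 (Ideal.mem_span_singleton_self _)
    rw [Ideal.mem_comap, this]
    exact m.zero_mem
  rw [hy, mem_vanishingIdeal_singleton_iff, viehwegPoly, map_sub, map_mul, aeval_X, aeval_X,
    aeval_rename, sub_eq_zero] at hmem
  have h : (y ∘ Sum.inl) 0 * (y ∘ Sum.inl) 1 = eval (y ∘ Sum.inr) (∏ i, f i ^ a i) := by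
    rw [← coe_aeval_eq_eval]
    exact hmem
  refine ⟨y ∘ Sum.inl, y ∘ Sum.inr, h, Ideal.comap_injective_of_surjective q hq ?_⟩
  rw [hy]
  have hcomp : (evalHom _ _ h).comp q =
      (aeval y : MvPolynomial (Fin 2 ⊕ Fin n) ℂ →ₐ[ℂ] ℂ).toRingHom := by
    refine MvPolynomial.ringHom_ext (fun c => ?_) (fun k => ?_)
    · have : q (C c) = base f a (C c) := by simp [base, q]
      rw [RingHom.comp_apply, this]
      simp [evalHom]
    · rcases k with i | j
      · have : q (X (Sum.inl i)) = coord f a i := rfl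
        rw [RingHom.comp_apply, this]
        simp [evalHom]
      · have : q (X (Sum.inr j)) = base f a (X j) := by simp [base, q]
        rw [RingHom.comp_apply, this]
        simp [evalHom]
  rw [RingHom.comap_ker, hcomp]
  ext p
  rw [mem_vanishingIdeal_singleton_iff]
  rfl

end ViehwegRing

/-! ### Closed points of the surface -/

/-- In dimension two, a nonzero prime of height different from one is maximal. -/
theorem Ideal.isMaximal_of_height_ne_one {R : Type*} [CommRing R] [IsDomain R]
    (hdim : ringKrullDim R = 2) (q : Ideal R) [hq : q.IsPrime] (h0 : q ≠ ⊥) (h1 : q.height ≠ 1) :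
    q.IsMaximal := by
  obtain ⟨m, hm, hqm⟩ := q.exists_le_maximal hq.ne_top
  by_contra hqmax
  have hlt : q < m := lt_of_le_of_ne hqm fun h => hqmax (h ▸ hm)
  have h2 := Ideal.height_add_one_le_of_lt_of_isPrime hlt
  have h3 := Ideal.height_le_ringKrullDim_of_ne_top hm.ne_top
  rw [hdim] at h3
  have h3' : m.height ≤ 2 := WithBot.coe_le_coe.1 h3
  have h4 : q.height ≠ 0 := fun h => h0 (Ideal.height_eq_zero_iff_eq_bot.1 h)
  have h5 := h2.trans h3'
  generalize q.height = k at *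
  induction k with
  | top => simp at h5
  | coe k =>
    norm_cast at *
    omega

namespace ViehwegRing

open MvPolynomial

variable {t : ℕ} {f : Fin t → MvPolynomial (Fin 1) ℂ} {a : Fin t → ℕ}

/-- If a closed point lies on a closed curve isomorphic to the affine line, its class is zero. -/
theorem of_quotient_ker_eq_zero (φ : ViehwegRing f a →+* ℂ)
    (e : ViehwegRing f a →+* Polynomial ℂ) (he : Function.Surjective e) (c : ℂ)
    (h : φ = (Polynomial.evalRingHom c).comp e) :
    G0.of (ViehwegRing f a) (ViehwegRing f a ⧸ RingHom.ker φ) = 0 := by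
  rw [h, ← RingHom.comap_ker, Polynomial.ker_evalRingHom]
  exact G0.of_quotient_comap_span_singleton e he (Polynomial.X_sub_C_ne_zero c)

/-- Every closed point of the surface `u v = g(x)` lies on an affine line: on the curve `u = u₀`,
which has coordinate `x`, if `u₀ ≠ 0`, and on the line `u = 0`, `x = x₀`, with coordinate `v`,
if `u₀ = 0`. -/
theorem of_quotient_eq_zero_of_isMaximal (m : Ideal (ViehwegRing f a)) [m.IsMaximal] :
    G0.of (ViehwegRing f a) (ViehwegRing f a ⧸ m) = 0 := by
  obtain ⟨w, x, h, rfl⟩ := exists_eq_ker_evalHom m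
  by_cases hw : w 0 = 0
  · have hg : ∀ g, (Polynomial.C.comp (eval x)) g = Polynomial.C (eval x g) := fun g => rfl
    let w' : Fin 2 → Polynomial ℂ := ![0, Polynomial.X]
    have hw' : w' 0 * w' 1 = (Polynomial.C.comp (eval x)) (∏ i, f i ^ a i) := by
      rw [hg, ← h, hw]
      simp [w']
    have hcomp : (lift f a _ w' hw').comp (Polynomial.eval₂RingHom ((base f a).comp C)
        (coord f a 1)) = RingHom.id _ :=
      Polynomial.ringHom_ext (fun c => by simp) (by simp [w'])
    refine of_quotient_ker_eq_zero _ (lift f a _ w' hw')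
      (fun p => ⟨_, RingHom.congr_fun hcomp p⟩) (w 1) (ringHom_ext ?_ fun i => ?_)
    · ext <;> simp [evalHom]
    · fin_cases i <;> simp [evalHom, w', hw]
  · let β : MvPolynomial (Fin 1) ℂ →+* Polynomial ℂ := eval₂Hom Polynomial.C fun _ => Polynomial.X
    let w' : Fin 2 → Polynomial ℂ :=
      ![Polynomial.C (w 0), Polynomial.C (w 0)⁻¹ * β (∏ i, f i ^ a i)]
    have hw' : w' 0 * w' 1 = β (∏ i, f i ^ a i) := by
      simp only [w', Matrix.cons_val_zero, Matrix.cons_val_one]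
      rw [← mul_assoc, ← map_mul, mul_inv_cancel₀ hw, map_one, one_mul]
    have hcomp : (lift f a _ w' hw').comp (Polynomial.eval₂RingHom ((base f a).comp C)
        (base f a (X 0))) = RingHom.id _ :=
      Polynomial.ringHom_ext (fun c => by simp [β]) (by simp [β])
    have hβ : (Polynomial.evalRingHom (x 0)).comp β = eval x := by
      refine MvPolynomial.ringHom_ext (fun c => by simp [β]) fun i => ?_
      rw [Subsingleton.elim i 0]
      simp [β]
    refine of_quotient_ker_eq_zero _ (lift f a _ w' hw')
      (fun p => ⟨_, RingHom.congr_fun hcomp p⟩) (x 0) (ringHom_ext ?_ fun i => ?_)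
    · refine RingHom.ext fun p => ?_
      simpa [evalHom] using (RingHom.congr_fun hβ p).symm
    · fin_cases i
      · simp [evalHom, w']
      · have hβ' := RingHom.congr_fun hβ (∏ i, f i ^ a i)
        rw [← h, RingHom.comp_apply, Polynomial.coe_evalRingHom] at hβ'
        simp only [evalHom, lift_coord, RingHom.comp_apply, w', Polynomial.coe_evalRingHom,
          Polynomial.eval_mul, Polynomial.eval_C, Fin.mk_one, Matrix.cons_val_one,
          Matrix.cons_val_fin_one]
        rw [hβ', inv_mul_cancel_left₀ hw]

end ViehwegRing

end

theorem mainTheorem5 {n t : ℕ} (f : Fin t → MvPolynomial (Fin n) ℂ) (a : Fin t → ℕ)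
    (hf : ∀ i, Irreducible (f i))
    (hcop : Pairwise fun i j => IsRelPrime (f i) (f j))
    (ha : ∀ i, 1 ≤ a i)
    (hdim : ringKrullDim (ViehwegRing f a) = 2) :
    ∃ (_ : IsDomain (ViehwegRing f a)) (_ : IsIntegrallyClosed (ViehwegRing f a)),
      Nonempty (G0 (ViehwegRing f a) ≃+ ℤ × DivisorClassGroup (ViehwegRing f a)) := by
  have hg : ∏ i, f i ^ a i ≠ 0 :=
    Finset.prod_ne_zero_iff.2 fun i _ => pow_ne_zero _ (hf i).ne_zero
  have hdom := ViehwegRing.isDomain hg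
  have hnormal := ViehwegRing.isIntegrallyClosed hg
  obtain rfl := ViehwegRing.eq_one_of_ringKrullDim_eq_two hg hdim
  refine ⟨hdom, hnormal, G0.nonempty_equiv fun q hq h0 h1 => ?_⟩
  have := Ideal.isMaximal_of_height_ne_one hdim q h0 h1
  exact ViehwegRing.of_quotient_eq_zero_of_isMaximal q
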